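/- For $v\in[0,1]$ let $\mathrm{PR}_v(a,b|x,y)$ ($a,b,x,y\in\{0,1\}$) be the noisy PR box, equal to $\frac38+\frac v8$ if $a+b=xy \bmod 2$ and to $\frac18-\frac v8$ otherwise. Let $n\ge 1$. A behavior is a family $P(\mathbf a,\mathbf b|\mathbf x,\mathbf y)$, $\mathbf a,\mathbf b,\mathbf x,\mathbf y\in\{0,1\}^n$, that is a probability distribution in $(\mathbf a,\mathbf b)$ for each pair of inputs $(\mathbf x,\mathbf y)$. Write $\mathbf s_{\le i}=(s_1,\dots,s_i)$. For $0\le i,j\le n$ let $\mathrm{NS}_{i,j}$ be the condition that the marginal $P(\mathbf a_{\le i},\mathbf b_{\le j}|\mathbf x,\mathbf y)$ depends on the inputs only through $(\mathbf x_{\le i},\mathbf y_{\le j})$. A behavior is * ABNS if the marginal $P(\mathbf a|\mathbf x,\mathbf y)$ does not depend on $\mathbf y$ and the marginal $P(\mathbf b|\mathbf x,\mathbf y)$ does not depend on $\mathbf x$; * TONS if $\mathrm{NS}_{i,n}$ and $\mathrm{NS}_{n,i}$ hold for all $0\le i<n$; * WTONS if $\mathrm{NS}_{i,i+1}$ and $\mathrm{NS}_{i+1,i}$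 hold for all $0\le i<n$. For $\mathrm{NS}\in\{\mathrm{ABNS},\mathrm{TONS},\mathrm{WTONS}\}$ and fixed inputs $\mathbf x^*,\mathbf y^*\in\{0,1\}^n$, the optimal guessing probability is $$G_n(v)=\max\ \sum_{\boldsymbol\alpha\in\{0,1\}^n}p(\boldsymbol\alpha)\,P_{\boldsymbol\alpha}(\mathbf a=\boldsymbol\alpha|\mathbf x^*,\mathbf y^*),$$ where the maximum is over all probability distributions $p$ on $\{0,1\}^n$ and all families $(P_{\boldsymbol\alpha})_{\boldsymbol\alpha\in\{0,1\}^n}$ of behaviors satisfying $\mathrm{NS}$ such that $\sum_{\boldsymbol\alpha}p(\boldsymbol\alpha)P_{\boldsymbol\alpha}(\mathbf a,\mathbf b|\mathbf x,\mathbf y)=\prod_{i=1}^n\mathrm{PR}_v(a_i,b_i|x_i,y_i)$ for all $\mathbf a,\mathbf b,\mathbf x,\mathbf y$. For $n\in\{2,3\}$, all $v\in[0,1]$ and every choice of $\mathbf x^*,\mathbf y^*$, the maximum is attained and has the following value. * $n=2$, ABNS: $G_2(v)=1-\frac12v$ if $v\le\sqrt2-1$, and $G_2(v)=\frac98-\frac34v-\frac18v^2$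 if $v\ge\sqrt2-1$. * $n=2$, TONS and WTONS: $G_2(v)=1-\frac34v$. * $n=3$, ABNS: $G_3(v)=1-\frac12v$ if $v\le v_1$; $G_3(v)=\frac{67}{64}-\frac{45}{64}v-\frac3{64}v^2+\frac1{64}v^3$ if $v_1\le v\le v_2$; and $G_3(v)=\frac{41}{32}-\frac{27}{32}v-\frac9{32}v^2-\frac1{32}v^3$ if $v\ge v_2$. Here $v_1$ is the unique root of $x^3-3x^2-13x+3$ in $[0,1]$, $v_2$ is the unique root of $x^3+5x^2+3x-5$ in $[0,1]$, and $|v_1-0.22038|<10^{-5}$, $|v_2-0.70928|<10^{-5}$. * $n=3$, TONS and WTONS: $G_3(v)=1-\frac{29}{32}v+\frac18v^2+\frac1{32}v^3$ if $v\le\sqrt5-2$, and $G_3(v)=1-\frac78v$ if $v\ge\sqrt5-2$. -/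

import Mathlib

open scoped BigOperators

/-- Strings of `n` bits. -/
abbrev BitString (n : ℕ) : Type := Fin n → Bool

/-- Tables `P(a,b|x,y)` of real numbers, in the argument order `P a b x y`; a table of conditional
probabilities is one that satisfies `IsBehavior` below. -/
abbrev Table (n : ℕ) : Type :=
  BitString n → BitString n → BitString n → BitString n → ℝ

/-- The noisy Popescu-Rohrlich box: `3/8 + v/8` if `a + b = x y mod 2`, and `1/8 - v/8` otherwise. -/
noncomputable def noisyPR (v : ℝ) (a b x y : Bool) : ℝ :=
  if (a ^^ b) = (x && y) then 3 / 8 + v / 8 else 1 / 8 - v / 8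

/-- `n` independent copies of the noisy PR box. -/
noncomputable def noisyPRProd (n : ℕ) (v : ℝ) : Table n :=
  fun a b x y => ∏ i, noisyPR v (a i) (b i) (x i) (y i)

/-- For every pair of inputs, `P` is a probability distribution on pairs of outputs. -/
structure IsBehavior {n : ℕ} (P : Table n) : Prop where
  nonneg : ∀ a b x y, 0 ≤ P a b x y
  sum_eq_one : ∀ x y, ∑ a, ∑ b, P a b x y = 1

/-- The strings `s` and `t` have the same first `i` bits. -/
def AgreeUpTo {n : ℕ} (i : ℕ) (s t : BitString n) : Prop :=
  ∀ k : Fin n, (k : ℕ) < i → s k = t k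

instance {n : ℕ} (i : ℕ) (s t : BitString n) : Decidable (AgreeUpTo i s t) :=
  inferInstanceAs (Decidable (∀ k : Fin n, (k : ℕ) < i → s k = t k))

/-- The marginal `P(a_{≤ i}, b_{≤ j} | x, y)`. Only the first `i` bits of `a` and the first `j` bits
of `b` matter. -/
noncomputable def prefixMarginal {n : ℕ} (P : Table n) (i j : ℕ) (a b x y : BitString n) : ℝ :=
  ∑ a', ∑ b', if AgreeUpTo i a a' ∧ AgreeUpTo j b b' then P a' b' x y else 0

/-- `P(a_{≤ i}, b_{≤ j} | x, y) = P(a_{≤ i}, b_{≤ j} | x_{≤ i}, y_{≤ j})`: the marginal of the first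
`i` outputs of Alice and the first `j` outputs of Bob does not depend on Alice's inputs after the
`i`-th nor on Bob's inputs after the `j`-th. -/
def PrefixNoSignaling {n : ℕ} (P : Table n) (i j : ℕ) : Prop :=
  ∀ a b x x' y y' : BitString n, AgreeUpTo i x x' → AgreeUpTo j y y' →
    prefixMarginal P i j a b x y = prefixMarginal P i j a b x' y'

/-- Alice-Bob no-signaling. -/
def ABNS {n : ℕ} (P : Table n) : Prop :=
  (∀ b x x' y : BitString n, ∑ a, P a b x y = ∑ a, P a b x' y) ∧
    ∀ a x y y' : BitString n, ∑ b, P a b x y = ∑ b, P a b x y'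

/-- Time-ordered no-signaling. -/
def TONS {n : ℕ} (P : Table n) : Prop :=
  ∀ i < n, PrefixNoSignaling P i n ∧ PrefixNoSignaling P n i

/-- Weakly time-ordered no-signaling. -/
def WTONS {n : ℕ} (P : Table n) : Prop :=
  ∀ i < n, PrefixNoSignaling P i (i + 1) ∧ PrefixNoSignaling P (i + 1) i

/-- Eve's strategies: with probability `p α` she guesses `α` and the devices behave according to the
table `Q α`. Every `Q α` obeys the no-signaling condition `NS`, and on average Alice and Bob
observe `n` independent copies of the noisy PR box. -/
structure IsStrategy {n : ℕ} (NS : Table n → Prop) (v : ℝ)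
    (p : BitString n → ℝ) (Q : BitString n → Table n) : Prop where
  nonneg : ∀ α, 0 ≤ p α
  sum_eq_one : ∑ α, p α = 1
  isBehavior : ∀ α, IsBehavior (Q α)
  noSignaling : ∀ α, NS (Q α)
  average : ∀ a b x y, ∑ α, p α * Q α a b x y = noisyPRProd n v a b x y

/-- The probability that Eve's guess equals Alice's output string when the inputs are `xs`, `ys`. -/
noncomputable def successProb {n : ℕ} (xs ys : BitString n)
    (p : BitString n → ℝ) (Q : BitString n → Table n) : ℝ :=
  ∑ α, p α * ∑ b, Q α α b xs ys

/-- The success probabilities of all of Eve's strategies. -/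
def successProbs {n : ℕ} (NS : Table n → Prop) (v : ℝ) (xs ys : BitString n) : Set ℝ :=
  {g | ∃ p Q, IsStrategy NS v p Q ∧ successProb xs ys p Q = g}

/-- `g` is the optimal guessing probability `G_n(v)` under the condition `NS`: whichever inputs
`xs`, `ys` are used, `g` is the largest success probability of a strategy, and it is attained. -/
def IsGuessingProb {n : ℕ} (NS : Table n → Prop) (v g : ℝ) : Prop :=
  ∀ xs ys : BitString n, IsGreatest (successProbs NS v xs ys) g

/-! Everything is phrased through the error string `e = a + b + xy`, whose bits are independent with
error probability `ε = (1 - v) / 4`. Relabelings preserving `e` move the inputs `(xs, ys)` to zero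
and any guess to the zero string, so averaging the relabeled tables turns a strategy into one table
with this error law, and randomizing the relabeling reverses this. The guessing probability becomes
the largest probability of `a = 0` at inputs zero (`isGuessingProb_of_forall_le`).

ABNS. Let `f` be subadditive with values in `[0, 1]`. At `x = 0` one has `1_{a = 0} + f b ≤ 1 + f
e`, and at `x = 1...1` one has `f (a + y) ≤ f b + f e`. The law of `b` is the same in both cases,
and averaging over `y` makes `a + y` uniform; this gives `ABNS.zeroProb_le`, applied to `f = min
(weight / m) 1`. For the converse (`exists_abns`), a joint law of `b` and `e` with `b + e` uniform
serves every nonzero `x`, while a maximal coupling of the same two marginals serves `x = 0`.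
Explicit joint laws attain the bound for `m = n, ..., 1`, from large noise to small noise.

TONS and WTONS. TONS implies WTONS, so it suffices to bound WTONS from above and to build TONS
tables. Given the history, the last round is a no-signaling box, in which the excess of `P(a = 0)`
over one half is at most half the sum of the four error probabilities. Iterating gives `1/4 + 3ε`
and `1/8 + 7ε/2`. For three rounds at large noise it is better to use `P(a = 0) ≤ 1` in the third
round after two correct rounds; the resulting weights on the histories give
`WTONS.zeroProb_three_le'`. The matching tables are built round by round (`TONS.extend`), with
errors concentrated on histories where Alice's outputs vanish. A transfer of mass `X` repairs
positivity at large noise. -/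

/-! ### Bitwise algebra of strings -/

instance {n : ℕ} : XorOp (BitString n) := ⟨fun a b i => a i ^^ b i⟩

instance {n : ℕ} : AndOp (BitString n) := ⟨fun a b i => a i && b i⟩

/-- The string of zeros. -/
def zeros (n : ℕ) : BitString n := fun _ => false

namespace BitString

variable {n : ℕ}

@[simp] theorem xor_apply (a b : BitString n) (i : Fin n) : (a ^^^ b) i = (a i ^^ b i) := rfl

@[simp] theorem and_apply (a b : BitString n) (i : Fin n) : (a &&& b) i = (a i && b i) := rfl

@[simp] theorem zeros_apply (i : Fin n) : zeros n i = false := rfl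

@[simp] theorem bxor_bxor_self (a b : BitString n) : a ^^^ b ^^^ b = a := by
  ext i; simp

@[simp] theorem bxor_zeros (a : BitString n) : a ^^^ zeros n = a := by
  ext i; simp

@[simp] theorem zeros_bxor (a : BitString n) : zeros n ^^^ a = a := by
  ext i; simp

@[simp] theorem bxor_self (a : BitString n) : a ^^^ a = zeros n := by
  ext i; simp

@[simp] theorem zeros_and (a : BitString n) : zeros n &&& a = zeros n := by
  ext i; simp

@[simp] theorem and_zeros (a : BitString n) : a &&& zeros n = zeros n := by
  ext i; simp

theorem bxor_comm (a b : BitString n) : a ^^^ b = b ^^^ a := by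
  ext i; simp [Bool.xor_comm]

theorem bxor_assoc (a b c : BitString n) : a ^^^ b ^^^ c = a ^^^ (b ^^^ c) := by
  ext i; simp

/-- Adding a fixed string is a permutation of the strings. -/
def xorRight (c : BitString n) : BitString n ≃ BitString n where
  toFun a := a ^^^ c
  invFun a := a ^^^ c
  left_inv a := by simp
  right_inv a := by simp

theorem sum_xor_right {M : Type*} [AddCommMonoid M] (c : BitString n) (f : BitString n → M) :
    ∑ a, f (a ^^^ c) = ∑ a, f a :=
  (xorRight c).sum_comp f

theorem sum_xor_left {M : Type*} [AddCommMonoid M] (c : BitString n) (f : BitString n → M) :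
    ∑ a, f (c ^^^ a) = ∑ a, f a := by
  simp_rw [bxor_comm c]
  exact sum_xor_right c f

theorem card_eq : (Fintype.card (BitString n) : ℝ) = 2 ^ n := by
  simp

end BitString

open BitString

/-- The probability of the error string `e` when the bits are wrong independently with
probability `ε`. -/
noncomputable def errorWeight {n : ℕ} (ε : ℝ) (e : BitString n) : ℝ :=
  ∏ i, if e i then ε else 1 - ε

/-- The error string `a + b - x y` of a table is distributed as `n` independent bits with error
probability `ε`, for all inputs. -/
def HasErrorLaw {n : ℕ} (ε : ℝ) (P : Table n) : Prop :=
  ∀ e x y, ∑ a, P a (a ^^^ e ^^^ (x &&& y)) x y = errorWeight ε e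

/-- The probability that Alice's outputs vanish when all inputs vanish. -/
noncomputable def zeroProb {n : ℕ} (P : Table n) : ℝ := ∑ b, P (zeros n) b (zeros n) (zeros n)

/-- Local relabelings that preserve the error string and move the inputs `(s, t)` to zero. -/
def relabel {n : ℕ} (s t α : BitString n) (P : Table n) : Table n := fun a b x y =>
  P (a ^^^ ((x &&& t) ^^^ α)) (b ^^^ ((s &&& y) ^^^ (s &&& t) ^^^ α)) (x ^^^ s) (y ^^^ t)

/-- A condition on tables that is invariant under relabelings and linear combinations. -/
structure IsSymmetricClass {n : ℕ} (NS : Table n → Prop) : Prop where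
  relabel : ∀ P, NS P → ∀ s t α, NS (relabel s t α P)
  sum : ∀ (p : BitString n → ℝ) (Q : BitString n → Table n), (∀ α, NS (Q α)) →
    NS fun a b x y => ∑ α, p α * Q α a b x y

/-! ### Reduction from strategies to a single table -/

section Reduction

variable {n : ℕ}

theorem noisyPR_eq (v : ℝ) (a b x y : Bool) :
    noisyPR v a b x y =
      1 / 2 * if (a ^^ b ^^ (x && y)) then (1 - v) / 4 else 1 - (1 - v) / 4 := by
  cases a <;> cases b <;> cases x <;> cases y <;> simp [noisyPR] <;> ring

theorem noisyPRProd_eq (v : ℝ) (a b x y : BitString n) :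
    noisyPRProd n v a b x y = (1 / 2) ^ n * errorWeight ((1 - v) / 4) (a ^^^ b ^^^ (x &&& y)) := by
  simp only [noisyPRProd, noisyPR_eq, errorWeight, Finset.prod_mul_distrib]
  simp

theorem sum_errorWeight (ε : ℝ) : ∑ e : BitString n, errorWeight ε e = 1 := by
  have h := Finset.prod_univ_sum (κ := fun _ : Fin n => Bool) (fun _ => Finset.univ)
    (fun _ c => if c then ε else 1 - ε)
  simp only [Fintype.piFinset_univ] at h
  rw [show (∑ e : BitString n, errorWeight ε e) = _ from h.symm]
  simp

theorem errorWeight_nonneg {ε : ℝ} (h0 : 0 ≤ ε) (h1 : ε ≤ 1) (e : BitString n) :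
    0 ≤ errorWeight ε e :=
  Finset.prod_nonneg fun i _ => by split_ifs <;> linarith

theorem sum_sum_eq_sum_error (P : BitString n → BitString n → ℝ) (z : BitString n) :
    ∑ a, ∑ b, P a b = ∑ e, ∑ a, P a (a ^^^ e ^^^ z) := by
  rw [Finset.sum_comm (s := (Finset.univ : Finset (BitString n)))
    (f := fun e a => P a (a ^^^ e ^^^ z))]
  refine Finset.sum_congr rfl fun a _ => ?_
  rw [← sum_xor_left a, ← sum_xor_right z]
  simp only [bxor_assoc]

theorem HasErrorLaw.sum_eq_one {ε : ℝ} {P : Table n} (h : HasErrorLaw ε P) (x y : BitString n) :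
    ∑ a, ∑ b, P a b x y = 1 := by
  rw [sum_sum_eq_sum_error _ (x &&& y)]
  simp only [h _ x y, sum_errorWeight]

theorem IsBehavior.relabel {P : Table n} (h : IsBehavior P) (s t α : BitString n) :
    IsBehavior (relabel s t α P) where
  nonneg _ _ _ _ := h.nonneg _ _ _ _
  sum_eq_one x y := by
    rw [← h.sum_eq_one (x ^^^ s) (y ^^^ t)]
    simp only [_root_.relabel]
    rw [← sum_xor_right ((x &&& t) ^^^ α) fun a => ∑ b, P a b _ _]
    exact Finset.sum_congr rfl fun a _ => sum_xor_right _ (P _ · _ _)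

theorem isBehavior_sum {p : BitString n → ℝ} {Q : BitString n → Table n} (hp : ∀ α, 0 ≤ p α)
    (h1 : ∑ α, p α = 1) (hQ : ∀ α, IsBehavior (Q α)) :
    IsBehavior fun a b x y => ∑ α, p α * Q α a b x y where
  nonneg a b x y := Finset.sum_nonneg fun α _ => mul_nonneg (hp α) ((hQ α).nonneg _ _ _ _)
  sum_eq_one x y := by
    simp_rw [Finset.sum_comm (t := (Finset.univ : Finset (BitString n)))
      (f := fun b α => p α * Q α _ b x y)]
    rw [Finset.sum_comm]
    simp_rw [← Finset.mul_sum, (hQ _).sum_eq_one, mul_one, h1]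

/-- The relabeling shifts `a + b` by `xt + sy + st`, which is exactly the change of `xy` under `x +
s`, `y + t`; hence it keeps the error string. At inputs zero it reads `Q α` at `(xs, ys)` with
output `α`, so every guess becomes the guess zero. -/
theorem exists_average_of_isStrategy {NS : Table n → Prop} (hNS : IsSymmetricClass NS) {v : ℝ}
    (xs ys : BitString n) {p : BitString n → ℝ} {Q : BitString n → Table n}
    (h : IsStrategy NS v p Q) :
    ∃ R, IsBehavior R ∧ NS R ∧ HasErrorLaw ((1 - v) / 4) R ∧
      zeroProb R = successProb xs ys p Q := by
  refine ⟨fun a b x y => ∑ α, p α * relabel xs ys α (Q α) a b x y,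
    isBehavior_sum h.nonneg h.sum_eq_one fun α => (h.isBehavior α).relabel _ _ _,
    hNS.sum _ _ fun α => hNS.relabel _ (h.noSignaling α) _ _ _, ?_, ?_⟩
  · intro e x y
    rw [Finset.sum_comm]
    have key : ∀ α, ∑ a, p α * relabel xs ys α (Q α) a (a ^^^ e ^^^ (x &&& y)) x y =
        ∑ a, p α * Q α a (a ^^^ (e ^^^ ((x ^^^ xs) &&& (y ^^^ ys)))) (x ^^^ xs) (y ^^^ ys) := by
      intro α
      rw [← sum_xor_right ((x &&& ys) ^^^ α) fun a => p α * Q α a _ _ _]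
      refine Finset.sum_congr rfl fun a _ => ?_
      simp only [relabel]
      congr 2
      ext i
      simp only [xor_apply, and_apply]
      generalize a i = a; generalize e i = e; generalize x i = x; generalize y i = y
      generalize xs i = s; generalize ys i = t; generalize α i = α
      revert a e x y s t α
      decide
    simp_rw [key]
    rw [Finset.sum_comm]
    simp_rw [h.average, noisyPRProd_eq]
    have : ∀ a : BitString n, a ^^^ (a ^^^ (e ^^^ ((x ^^^ xs) &&& (y ^^^ ys)))) ^^^
        ((x ^^^ xs) &&& (y ^^^ ys)) = e := by
      intro a
      rw [← bxor_assoc, ← bxor_assoc, bxor_self, zeros_bxor, bxor_bxor_self]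
    simp_rw [this]
    rw [Finset.sum_const, nsmul_eq_mul, Finset.card_univ, card_eq, ← mul_assoc, ← mul_pow]
    norm_num
  · simp only [zeroProb, successProb, relabel]
    rw [Finset.sum_comm]
    refine Finset.sum_congr rfl fun α _ => ?_
    rw [← Finset.mul_sum]
    simp only [zeros_bxor, zeros_and, and_zeros]
    rw [sum_xor_right ((xs &&& ys) ^^^ α) fun b => Q α α b xs ys]

/-- A uniform shift `α` of both outputs makes them uniform given the error string, as in the noisy
PR product. The extra `xs &&& ys` in the shift cancels the relabeling term at `(xs, ys)`, so that
output `α` there corresponds to output zero of `R`. -/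
theorem exists_isStrategy {NS : Table n → Prop} (hNS : IsSymmetricClass NS) {v : ℝ}
    (xs ys : BitString n) {R : Table n} (hB : IsBehavior R) (hR : NS R)
    (hE : HasErrorLaw ((1 - v) / 4) R) :
    ∃ p Q, IsStrategy NS v p Q ∧ successProb xs ys p Q = zeroProb R := by
  have hsum : ∑ _α : BitString n, (1 / 2 : ℝ) ^ n = 1 := by
    rw [Finset.sum_const, nsmul_eq_mul, Finset.card_univ, card_eq, ← mul_pow]
    norm_num
  refine ⟨fun _ => (1 / 2) ^ n, fun α => relabel xs ys ((xs &&& ys) ^^^ α) R,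
    ⟨fun _ => by positivity, hsum, fun α => hB.relabel _ _ _, fun α => hNS.relabel _ hR _ _ _, ?_⟩,
    ?_⟩
  · intro a b x y
    rw [noisyPRProd_eq, ← Finset.mul_sum, ← hE _ (x ^^^ xs) (y ^^^ ys),
      ← sum_xor_left (a ^^^ (x &&& ys) ^^^ (xs &&& ys)) fun a => R a _ _ _]
    congr 1
    refine Finset.sum_congr rfl fun α _ => ?_
    simp only [relabel]
    congr 1
    · ext i
      simp only [xor_apply, and_apply]
      cases a i <;> cases (x i && ys i) <;> cases (xs i && ys i) <;> cases α i <;> rfl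
    · ext i
      simp only [xor_apply, and_apply]
      generalize a i = a; generalize b i = b; generalize x i = x; generalize y i = y
      generalize xs i = s; generalize ys i = t; generalize α i = α
      revert a b x y s t α
      decide
  · simp only [zeroProb, successProb, relabel]
    rw [← Finset.mul_sum]
    have key : ∀ α : BitString n, ∑ b, R (α ^^^ ((xs &&& ys) ^^^ ((xs &&& ys) ^^^ α)))
        (b ^^^ ((xs &&& ys) ^^^ (xs &&& ys) ^^^ ((xs &&& ys) ^^^ α))) (xs ^^^ xs) (ys ^^^ ys) =
        ∑ b, R (zeros n) b (zeros n) (zeros n) := by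
      intro α
      rw [sum_xor_right _ fun b => R _ b _ _, bxor_self, bxor_self, ← bxor_assoc (xs &&& ys),
        bxor_self, zeros_bxor, bxor_self]
    simp_rw [key]
    rw [Finset.mul_sum, ← Finset.sum_mul, hsum, one_mul]

/-- The guessing probability is the largest probability of the output zero for the inputs zero,
over single tables with the right error distribution. -/
theorem isGuessingProb_of_forall_le {NS : Table n → Prop} (hNS : IsSymmetricClass NS) {v g : ℝ}
    (hle : ∀ R, IsBehavior R → NS R → HasErrorLaw ((1 - v) / 4) R → zeroProb R ≤ g)
    (hge : ∃ R, IsBehavior R ∧ NS R ∧ HasErrorLaw ((1 - v) / 4) R ∧ g ≤ zeroProb R) :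
    IsGuessingProb NS v g := by
  intro xs ys
  constructor
  · obtain ⟨R, hB, hR, hE, hg⟩ := hge
    obtain ⟨p, Q, hS, hs⟩ := exists_isStrategy hNS xs ys hB hR hE
    exact ⟨p, Q, hS, hs.trans (le_antisymm (hle R hB hR hE) hg)⟩
  · rintro _ ⟨p, Q, hS, rfl⟩
    obtain ⟨R, hB, hR, hE, hs⟩ := exists_average_of_isStrategy hNS xs ys hS
    exact hs ▸ hle R hB hR hE

theorem isSymmetricClass_abns : IsSymmetricClass (n := n) ABNS where
  relabel P h s t α := by
    constructor
    · intro b x x' y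
      simp only [relabel]
      rw [sum_xor_right _ fun a => P a _ _ _, sum_xor_right _ fun a => P a _ _ _]
      exact h.1 _ _ _ _
    · intro a x y y'
      simp only [relabel]
      rw [sum_xor_right _ fun b => P _ b _ _, sum_xor_right _ fun b => P _ b _ _]
      exact h.2 _ _ _ _
  sum p Q h := by
    constructor
    · intro b x x' y
      rw [Finset.sum_comm, Finset.sum_comm (f := fun a α => p α * Q α a b x' y)]
      simp_rw [← Finset.mul_sum, (h _).1 b x x' y]
    · intro b x y y'
      rw [Finset.sum_comm, Finset.sum_comm (f := fun a α => p α * Q α b a x y')]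
      simp_rw [← Finset.mul_sum, (h _).2 b x y y']

theorem AgreeUpTo.xor {i : ℕ} {s t s' t' : BitString n} (h : AgreeUpTo i s t)
    (h' : AgreeUpTo i s' t') : AgreeUpTo i (s ^^^ s') (t ^^^ t') := fun k hk => by
  simp [h k hk, h' k hk]

theorem AgreeUpTo.and {i : ℕ} {s t s' t' : BitString n} (h : AgreeUpTo i s t)
    (h' : AgreeUpTo i s' t') : AgreeUpTo i (s &&& s') (t &&& t') := fun k hk => by
  simp [h k hk, h' k hk]

theorem AgreeUpTo.refl (i : ℕ) (s : BitString n) : AgreeUpTo i s s := fun _ _ => rfl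

theorem agreeUpTo_xor_right {i : ℕ} {s t c : BitString n} :
    AgreeUpTo i (s ^^^ c) (t ^^^ c) ↔ AgreeUpTo i s t :=
  ⟨fun h => by simpa using h.xor (AgreeUpTo.refl i c), fun h => h.xor (AgreeUpTo.refl i c)⟩

theorem prefixMarginal_congr (P : Table n) {i j : ℕ} {a a' b b' : BitString n}
    (ha : AgreeUpTo i a a') (hb : AgreeUpTo j b b') (x y : BitString n) :
    prefixMarginal P i j a b x y = prefixMarginal P i j a' b' x y := by
  have h1 : ∀ c, AgreeUpTo i a c ↔ AgreeUpTo i a' c := fun c =>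
    ⟨fun h k hk => (ha k hk).symm.trans (h k hk), fun h k hk => (ha k hk).trans (h k hk)⟩
  have h2 : ∀ c, AgreeUpTo j b c ↔ AgreeUpTo j b' c := fun c =>
    ⟨fun h k hk => (hb k hk).symm.trans (h k hk), fun h k hk => (hb k hk).trans (h k hk)⟩
  simp only [prefixMarginal, h1, h2]

theorem PrefixNoSignaling.relabel {P : Table n} {i j : ℕ} (h : PrefixNoSignaling P i j)
    (s t α : BitString n) : PrefixNoSignaling (relabel s t α P) i j := by
  have key : ∀ a b x y, prefixMarginal (_root_.relabel s t α P) i j a b x y =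
      prefixMarginal P i j (a ^^^ ((x &&& t) ^^^ α)) (b ^^^ ((s &&& y) ^^^ (s &&& t) ^^^ α))
        (x ^^^ s) (y ^^^ t) := by
    intro a b x y
    simp only [prefixMarginal]
    rw [← sum_xor_right ((x &&& t) ^^^ α) fun a' => ∑ b', if _ ∧ _ then P a' b' _ _ else 0]
    refine Finset.sum_congr rfl fun a' _ => ?_
    rw [← sum_xor_right ((s &&& y) ^^^ (s &&& t) ^^^ α) fun b' => if _ ∧ _ then P _ b' _ _ else 0]
    simp only [agreeUpTo_xor_right, _root_.relabel]
  intro a b x x' y y' hx hy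
  rw [key, key, h _ _ _ (x' ^^^ s) _ (y' ^^^ t) (agreeUpTo_xor_right.2 hx)
    (agreeUpTo_xor_right.2 hy)]
  exact prefixMarginal_congr P
    ((AgreeUpTo.refl i a).xor ((hx.and (AgreeUpTo.refl i t)).xor (AgreeUpTo.refl i α)))
    ((AgreeUpTo.refl j b).xor ((((AgreeUpTo.refl j s).and hy).xor (AgreeUpTo.refl j _)).xor
      (AgreeUpTo.refl j α))) _ _

theorem prefixMarginal_sum {ι : Type*} [Fintype ι] (p : ι → ℝ) (Q : ι → Table n) (i j : ℕ)
    (a b x y : BitString n) :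
    prefixMarginal (fun a b x y => ∑ α, p α * Q α a b x y) i j a b x y =
      ∑ α, p α * prefixMarginal (Q α) i j a b x y := by
  have key : ∀ (q : Prop) [Decidable q] (f : ι → ℝ),
      (if q then ∑ α, p α * f α else 0) = ∑ α, p α * if q then f α else 0 := by
    intro q _ f
    split_ifs <;> simp
  simp only [prefixMarginal, key, Finset.mul_sum]
  rw [Finset.sum_comm (s := (Finset.univ : Finset ι))]
  refine Finset.sum_congr rfl fun a' _ => ?_
  rw [Finset.sum_comm (s := (Finset.univ : Finset ι))]

theorem PrefixNoSignaling.sum {ι : Type*} [Fintype ι] (p : ι → ℝ) {Q : ι → Table n} {i j : ℕ}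
    (h : ∀ α, PrefixNoSignaling (Q α) i j) :
    PrefixNoSignaling (fun a b x y => ∑ α, p α * Q α a b x y) i j := by
  intro a b x x' y y' hx hy
  simp_rw [prefixMarginal_sum, h _ a b x x' y y' hx hy]

theorem isSymmetricClass_tons : IsSymmetricClass (n := n) TONS where
  relabel _ h s t α i hi := ⟨(h i hi).1.relabel s t α, (h i hi).2.relabel s t α⟩
  sum p _ h i hi := ⟨.sum p fun α => (h α i hi).1, .sum p fun α => (h α i hi).2⟩

theorem isSymmetricClass_wtons : IsSymmetricClass (n := n) WTONS where
  relabel _ h s t α i hi := ⟨(h i hi).1.relabel s t α, (h i hi).2.relabel s t α⟩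
  sum p _ h i hi := ⟨.sum p fun α => (h α i hi).1, .sum p fun α => (h α i hi).2⟩

end Reduction

/-! ### Upper bound under Alice-Bob no-signaling -/

section ABNSUpperBound

variable {n : ℕ}

/-- The string of ones. -/
def ones (n : ℕ) : BitString n := fun _ => true

theorem HasErrorLaw.sum_mul_error {ε : ℝ} {P : Table n} (h : HasErrorLaw ε P)
    (f : BitString n → ℝ) (x y : BitString n) :
    ∑ a, ∑ b, f (a ^^^ b ^^^ (x &&& y)) * P a b x y = ∑ e, f e * errorWeight ε e := by
  rw [sum_sum_eq_sum_error _ (x &&& y)]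
  refine Finset.sum_congr rfl fun e _ => ?_
  rw [← h e x y, Finset.mul_sum]
  refine Finset.sum_congr rfl fun a _ => ?_
  rw [bxor_assoc a e, ← bxor_assoc a a, bxor_self, zeros_bxor, bxor_bxor_self]

/-- A subadditive function of the error string with values at most `1` bounds the probability of
the output zero under Alice-Bob no-signaling. -/
theorem ABNS.zeroProb_le {ε : ℝ} {P : Table n} (hP : ABNS P) (hB : IsBehavior P)
    (hE : HasErrorLaw ε P) (f : BitString n → ℝ) (f_le : ∀ a, f a ≤ 1)
    (f_nonneg : ∀ a, 0 ≤ f a) (f_xor : ∀ a b, f (a ^^^ b) ≤ f a + f b) :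
    zeroProb P ≤ 1 - (∑ a, f a) / 2 ^ n + 2 * ∑ e, f e * errorWeight ε e := by
  -- At `x = 0` the error string is `a + b`: if `a = 0` then `f b = f e`, and otherwise `f b ≤ 1`.
  have hx0 : ∀ y, zeroProb P + ∑ a, ∑ b, f b * P a b (ones n) y ≤
      1 + ∑ e, f e * errorWeight ε e := by
    intro y
    have h1 : zeroProb P = ∑ b, P (zeros n) b (zeros n) y := hP.2 _ _ _ _
    have h2 : ∑ a, ∑ b, f b * P a b (ones n) y = ∑ a, ∑ b, f b * P a b (zeros n) y := by
      rw [Finset.sum_comm, Finset.sum_comm (f := fun a b => f b * P a b (zeros n) y)]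
      simp_rw [← Finset.mul_sum, hP.1 _ (ones n) (zeros n) y]
    have h3 : zeroProb P = ∑ a, ∑ b, (if a = zeros n then 1 else 0) * P a b (zeros n) y := by
      simp [h1]
    rw [h2, h3, ← hE.sum_mul_error f (zeros n) y]
    refine le_of_le_of_eq ?_ (congrArg (· + _) (hB.sum_eq_one (zeros n) y))
    simp_rw [← Finset.sum_add_distrib]
    refine Finset.sum_le_sum fun a _ => Finset.sum_le_sum fun b _ => ?_
    rw [← add_mul, ← one_add_mul]
    refine mul_le_mul_of_nonneg_right ?_ (hB.nonneg _ _ _ _)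
    rw [zeros_and, bxor_zeros]
    split_ifs with h
    · rw [h, zeros_bxor]
    · rw [zero_add]
      exact (f_le b).trans (by linarith [f_nonneg (a ^^^ b)])
  -- At `x = 1...1` the error string is `a + b + y`, so `a + y = b + e`.
  have hx1 : ∀ y, ∑ a, ∑ b, f (a ^^^ y) * P a b (ones n) y ≤
      ∑ a, ∑ b, f b * P a b (ones n) y + ∑ e, f e * errorWeight ε e := by
    intro y
    rw [← hE.sum_mul_error f (ones n) y]
    simp_rw [← Finset.sum_add_distrib]
    refine Finset.sum_le_sum fun a _ => Finset.sum_le_sum fun b _ => ?_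
    rw [← add_mul]
    refine mul_le_mul_of_nonneg_right ?_ (hB.nonneg _ _ _ _)
    have : a ^^^ y = b ^^^ (a ^^^ b ^^^ (ones n &&& y)) := by
      ext i
      simp only [xor_apply, and_apply, ones]
      cases a i <;> cases b i <;> cases y i <;> rfl
    exact this ▸ f_xor _ _
  -- The law of `a` does not depend on `y`, so summing over all `y` makes `a + y` uniform.
  have hmean : ∑ y, ∑ a, ∑ b, f (a ^^^ y) * P a b (ones n) y = ∑ a, f a := by
    have : ∀ a y, ∑ b, f (a ^^^ y) * P a b (ones n) y =
        f (a ^^^ y) * ∑ b, P a b (ones n) (zeros n) := fun a y => by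
      rw [← Finset.mul_sum, hP.2 a (ones n) y (zeros n)]
    simp_rw [this]
    rw [Finset.sum_comm]
    simp_rw [← Finset.sum_mul, sum_xor_left _ f]
    rw [← Finset.mul_sum, hB.sum_eq_one, mul_one]
  have hsum : ∑ y : BitString n, (zeroProb P + ∑ a, ∑ b, f (a ^^^ y) * P a b (ones n) y) ≤
      ∑ _y : BitString n, (1 + 2 * ∑ e, f e * errorWeight ε e) :=
    Finset.sum_le_sum fun y _ => by linarith [hx0 y, hx1 y]
  rw [Finset.sum_add_distrib, hmean, Finset.sum_const, Finset.sum_const, Finset.card_univ,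
    nsmul_eq_mul, nsmul_eq_mul, card_eq] at hsum
  have h2 : (0 : ℝ) < 2 ^ n := by positivity
  have : zeroProb P + (∑ a, f a) / 2 ^ n ≤ 1 + 2 * ∑ e, f e * errorWeight ε e := by
    rw [← sub_nonneg] at hsum ⊢
    have h4 : 1 + 2 * ∑ e, f e * errorWeight ε e - (zeroProb P + (∑ a, f a) / 2 ^ n) =
        (2 ^ n * (1 + 2 * ∑ e, f e * errorWeight ε e) - (2 ^ n * zeroProb P + ∑ a, f a)) /
          2 ^ n := by
      field_simp
    rw [h4]
    exact div_nonneg hsum h2.le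
  linarith

end ABNSUpperBound

/-! ### Tables without Alice-Bob signaling from couplings -/

section ABNSLowerBound

variable {n : ℕ}

/-- Two distributions have a coupling whose diagonal dominates any common lower bound. -/
theorem exists_coupling {ι : Type*} [Fintype ι] [DecidableEq ι] {β π t : ι → ℝ}
    (ht : ∀ i, 0 ≤ t i) (htβ : ∀ i, t i ≤ β i) (htπ : ∀ i, t i ≤ π i)
    (hβ : ∑ i, β i = 1) (hπ : ∑ i, π i = 1) :
    ∃ K : ι → ι → ℝ, (∀ i j, 0 ≤ K i j) ∧ (∀ i, ∑ j, K i j = β i) ∧ (∀ j, ∑ i, K i j = π j) ∧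
      ∀ i, t i ≤ K i i := by
  have hβt : ∑ i, (β i - t i) = 1 - ∑ i, t i := by rw [Finset.sum_sub_distrib, hβ]
  have hπt : ∑ i, (π i - t i) = 1 - ∑ i, t i := by rw [Finset.sum_sub_distrib, hπ]
  have h0 : 0 ≤ 1 - ∑ i, t i := hβt ▸ Finset.sum_nonneg fun i _ => sub_nonneg.2 (htβ i)
  -- If the remaining mass is zero, so is every `r i - t i`, and division by zero gives the right
  -- value.
  have cancel : ∀ {r : ι → ℝ}, (∀ i, t i ≤ r i) → ∑ i, (r i - t i) = 1 - ∑ i, t i → ∀ i,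
      (r i - t i) * (1 - ∑ i, t i) / (1 - ∑ i, t i) = r i - t i := by
    intro r hr hs i
    rcases h0.eq_or_lt with h | h
    · rw [← h] at hs
      rw [(Finset.sum_eq_zero_iff_of_nonneg fun i _ => sub_nonneg.2 (hr i)).1 hs i
        (Finset.mem_univ i)]
      simp
    · exact mul_div_cancel_right₀ _ h.ne'
  -- Put `t` on the diagonal and couple the remainders independently.
  refine ⟨fun i j => (if i = j then t i else 0) + (β i - t i) * (π j - t j) / (1 - ∑ i, t i),
    fun i j => ?_, fun i => ?_, fun j => ?_, fun i => ?_⟩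
  · have := div_nonneg (mul_nonneg (sub_nonneg.2 (htβ i)) (sub_nonneg.2 (htπ j))) h0
    have h1 := ht i
    dsimp only
    split_ifs <;> linarith
  · rw [Finset.sum_add_distrib, ← Finset.sum_div, ← Finset.mul_sum, hπt, cancel htβ hβt]
    simp
  · rw [Finset.sum_add_distrib, ← Finset.sum_div, ← Finset.sum_mul, hβt,
      mul_comm (1 - _), cancel htπ hπt]
    simp
  · have := div_nonneg (mul_nonneg (sub_nonneg.2 (htβ i)) (sub_nonneg.2 (htπ i))) h0
    simp only [if_true]
    linarith

/-- A distribution `K` of Bob's output `b` and the error string `e` such that Alice's output `b + e`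
is uniform gives a table without signaling between Alice and Bob. -/
theorem exists_abns {ε : ℝ} (K : BitString n → BitString n → ℝ)
    (t : BitString n → ℝ) (hK : ∀ b e, 0 ≤ K b e) (hKe : ∀ e, ∑ b, K b e = errorWeight ε e)
    (hKa : ∀ a, ∑ b, K b (a ^^^ b) = (1 / 2) ^ n) (ht : ∀ e, 0 ≤ t e)
    (htK : ∀ b, t b ≤ ∑ e, K b e) (hte : ∀ e, t e ≤ errorWeight ε e) :
    ∃ R : Table n, IsBehavior R ∧ ABNS R ∧ HasErrorLaw ε R ∧ ∑ e, t e ≤ zeroProb R := by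
  -- At `x = 0` the output `a = b + e` need not be uniform, since `y` does not enter it. Only the
  -- law of `b` must agree with `K`, and the diagonal `b = e` is the event `a = 0`.
  obtain ⟨K₀, hK₀, hK₀b, hK₀e, hK₀t⟩ := exists_coupling ht htK hte
    (by rw [Finset.sum_comm]; simp_rw [hKe, sum_errorWeight]) (sum_errorWeight ε)
  have hlaw : HasErrorLaw ε fun a b x y =>
      if x = zeros n then K₀ b (a ^^^ b ^^^ (x &&& y)) else K b (a ^^^ b ^^^ (x &&& y)) := by
    intro e x y
    have : ∀ a : BitString n, a ^^^ (a ^^^ e ^^^ (x &&& y)) ^^^ (x &&& y) = e := fun a => by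
      rw [← bxor_assoc, ← bxor_assoc, bxor_self, zeros_bxor, bxor_bxor_self]
    simp_rw [this, bxor_assoc _ e]
    split_ifs
    · rw [sum_xor_right _ fun b => K₀ b e, hK₀e]
    · rw [sum_xor_right _ fun b => K b e, hKe]
  refine ⟨_, ⟨fun a b x y => ?_, hlaw.sum_eq_one⟩, ⟨?_, ?_⟩, hlaw, ?_⟩
  · split_ifs
    exacts [hK₀ _ _, hK _ _]
  · have key : ∀ b x y : BitString n, ∑ a, (if x = zeros n then K₀ b (a ^^^ b ^^^ (x &&& y))
        else K b (a ^^^ b ^^^ (x &&& y))) = ∑ e, K b e := by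
      intro b x y
      simp_rw [bxor_assoc _ b]
      split_ifs
      · rw [sum_xor_right _ fun e => K₀ b e, hK₀b]
      · rw [sum_xor_right _ fun e => K b e]
    intro b x x' y
    rw [key, key]
  · intro a x y y'
    dsimp only
    by_cases hx : x = zeros n
    · simp [hx]
    · simp only [if_neg hx]
      have key : ∀ z : BitString n, ∑ b, K b (a ^^^ b ^^^ z) = (1 / 2) ^ n := fun z => by
        rw [← hKa (a ^^^ z)]
        simp_rw [bxor_assoc, bxor_comm z]
      rw [key, key]
  · simp only [zeroProb, if_true, zeros_bxor, zeros_and, bxor_zeros]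
    exact Finset.sum_le_sum fun b _ => hK₀t b

end ABNSLowerBound

/-! ### Strings of length two and three, and weights -/

section SmallStrings

theorem BitString.eq_two (a : BitString 2) : a = ![a 0, a 1] := by
  ext i; fin_cases i <;> rfl

theorem BitString.eq_three (a : BitString 3) : a = ![a 0, a 1, a 2] := by
  ext i; fin_cases i <;> rfl

theorem BitString.forall_two {p : BitString 2 → Prop} (h : ∀ b c, p ![b, c]) (a : BitString 2) :
    p a :=
  a.eq_two ▸ h _ _

theorem BitString.forall_three {p : BitString 3 → Prop} (h : ∀ b c d, p ![b, c, d])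
    (a : BitString 3) : p a :=
  a.eq_three ▸ h _ _ _

theorem BitString.sum_two (f : BitString 2 → ℝ) : ∑ a, f a =
    f ![false, false] + f ![false, true] + f ![true, false] + f ![true, true] := by
  have h : (Finset.univ : Finset (BitString 2)) =
      {![false, false], ![false, true], ![true, false], ![true, true]} := by decide
  rw [h, Finset.sum_insert (by decide), Finset.sum_insert (by decide),
    Finset.sum_insert (by decide), Finset.sum_singleton]
  ring

theorem BitString.sum_three (f : BitString 3 → ℝ) : ∑ a, f a =
    f ![false, false, false] + f ![false, false, true] + f ![false, true, false] +
      f ![false, true, true] + f ![true, false, false] + f ![true, false, true] +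
      f ![true, true, false] + f ![true, true, true] := by
  have h : (Finset.univ : Finset (BitString 3)) =
      {![false, false, false], ![false, false, true], ![false, true, false],
        ![false, true, true], ![true, false, false], ![true, false, true],
        ![true, true, false], ![true, true, true]} := by decide
  rw [h]
  repeat rw [Finset.sum_insert (by decide)]
  rw [Finset.sum_singleton]
  ring

/-- The number of ones in a string. -/
def BitString.weight {n : ℕ} (a : BitString n) : ℕ := ∑ i, (a i).toNat

/-- The function of disjoint pairs of strings whose value depends on the weights only. -/
def ofWeights {n : ℕ} (k : ℕ → ℕ → ℝ) (b e : BitString n) : ℝ :=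
  if b &&& e = zeros n then k b.weight e.weight else 0

theorem BitString.weight_xor_le {n : ℕ} (a b : BitString n) :
    (a ^^^ b).weight ≤ a.weight + b.weight := by
  rw [weight, weight, weight, ← Finset.sum_add_distrib]
  exact Finset.sum_le_sum fun i _ => by
    rw [xor_apply]
    cases a i <;> cases b i <;> simp

end SmallStrings

/-! ### ABNS optimality criteria for couplings depending on weights -/

section ABNSGuessing

variable {n : ℕ} {v g : ℝ}

/-- The fraction of ones in the error string, counted in units of `m` and truncated at `1`,
bounds the guessing probability. -/
theorem abns_zeroProb_le_min_weight {P : Table n} (hP : ABNS P) (hB : IsBehavior P)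
    (hE : HasErrorLaw ((1 - v) / 4) P) {m : ℝ} (hm : 0 < m) :
    zeroProb P ≤ 1 - (∑ a : BitString n, min ((a.weight : ℝ) / m) 1) / 2 ^ n +
      2 * ∑ e : BitString n, min ((e.weight : ℝ) / m) 1 * errorWeight ((1 - v) / 4) e := by
  refine hP.zeroProb_le hB hE _ (fun a => min_le_right _ _)
    (fun a => le_min (by positivity) zero_le_one) fun a b => ?_
  have h : ((a ^^^ b).weight : ℝ) / m ≤ a.weight / m + b.weight / m := by
    rw [← add_div]
    gcongr
    exact_mod_cast weight_xor_le a b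
  rcases le_total ((a.weight : ℝ) / m) 1 with ha | ha
  · rcases le_total ((b.weight : ℝ) / m) 1 with hb | hb
    · rw [min_eq_left ha, min_eq_left hb]
      exact (min_le_left _ _).trans h
    · rw [min_eq_right hb]
      exact (min_le_right _ _).trans (le_add_of_nonneg_left (le_min (by positivity) zero_le_one))
  · rw [min_eq_right ha]
    exact (min_le_right _ _).trans (le_add_of_nonneg_right (le_min (by positivity) zero_le_one))

/-- Disjoint supports of `b` and `e` make the weight additive, as tightness of `f (b + e) ≤ f b + f
e` below the truncation demands. Equality of the two bounds is left as an assumption, `hg` against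
`hg0`. -/
theorem isGuessingProb_abns_of_weights {ε m : ℝ} (hε : (1 - v) / 4 = ε) (hε0 : 0 ≤ ε) (hε1 : ε ≤ 1)
    (hm : 0 < m) (k : ℕ → ℕ → ℝ)
    (hg : 1 - (∑ a : BitString n, min ((a.weight : ℝ) / m) 1) / 2 ^ n +
      2 * ∑ e : BitString n, min ((e.weight : ℝ) / m) 1 * errorWeight ε e = g)
    (hk : ∀ i j, 0 ≤ k i j)
    (hke : ∀ e : BitString n, ∑ b, ofWeights k b e = errorWeight ε e)
    (hka : ∀ a : BitString n, ∑ b, ofWeights k b (a ^^^ b) = (1 / 2) ^ n)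
    (hkb : ∀ b : BitString n, b ≠ zeros n → errorWeight ε b ≤ ∑ e : BitString n, ofWeights k b e)
    (h0 : ∑ e : BitString n, ofWeights k (zeros n) e ≤ errorWeight ε (zeros n))
    (hg0 : ∑ e : BitString n, ofWeights k (zeros n) e + 1 - errorWeight ε (zeros n) = g) :
    IsGuessingProb (n := n) ABNS v g := by
  subst hε
  have hk' : ∀ b e : BitString n, 0 ≤ ofWeights k b e := fun b e => by
    rw [ofWeights]
    split_ifs
    exacts [hk _ _, le_rfl]
  refine isGuessingProb_of_forall_le isSymmetricClass_abns (fun R hB hR hE =>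
    hg ▸ abns_zeroProb_le_min_weight hR hB hE hm) ?_
  -- The common lower bound of Bob's law and the error law is Bob's law at zero and the error law
  -- elsewhere.
  obtain ⟨R, hB, hR, hE, h⟩ := exists_abns (ofWeights k)
    (fun e => if e = zeros n then ∑ e : BitString n, ofWeights k (zeros n) e
      else errorWeight ((1 - v) / 4) e) hk' hke hka
    (fun e => by
      split_ifs
      · exact Finset.sum_nonneg fun e _ => hk' _ e
      · exact errorWeight_nonneg hε0 hε1 e)
    (fun b => by
      split_ifs with h
      · rw [h]
      · exact hkb b h)
    (fun e => by
      split_ifs with h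
      · rw [h]; exact h0
      · exact le_rfl)
  refine ⟨R, hB, hR, hE, h.trans_eq' ?_⟩
  have h1 := sum_errorWeight (n := n) ((1 - v) / 4)
  rw [← Finset.add_sum_erase _ _ (Finset.mem_univ (zeros n))] at h1
  rw [← Finset.add_sum_erase _ _ (Finset.mem_univ (zeros n)), if_pos rfl,
    Finset.sum_congr rfl fun e he => if_neg (Finset.ne_of_mem_erase he), ← hg0]
  linarith

/-- Uniformity of `b + e` is assumed only at weights zero and one; at weight two it follows from the
total mass. -/
theorem isGuessingProb_two_abns_of_weights {ε m c : ℝ} (hε : (1 - v) / 4 = ε) (hε0 : 0 ≤ ε)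
    (hε1 : ε ≤ 1) (hm : 0 < m) (hm2 : m ≤ 2) (hc : min (1 / m) 1 = c) (k : ℕ → ℕ → ℝ)
    (hg : 1 - (2 * c + 1) / 4 + 2 * (2 * c * (ε * (1 - ε)) + ε ^ 2) = g)
    (hk : ∀ i j, 0 ≤ k i j)
    (hke0 : k 0 0 + 2 * k 1 0 + k 2 0 = (1 - ε) ^ 2) (hke1 : k 0 1 + k 1 1 = ε * (1 - ε))
    (hke2 : k 0 2 = ε ^ 2)
    (hka0 : k 0 0 = 1 / 4) (hka1 : k 0 1 + k 1 0 = 1 / 4)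
    (hkb1 : ε * (1 - ε) ≤ k 1 0 + k 1 1) (hkb2 : ε ^ 2 ≤ k 2 0)
    (hg0 : k 0 0 + 2 * k 0 1 + k 0 2 + 1 - (1 - ε) ^ 2 = g) :
    IsGuessingProb (n := 2) ABNS v g := by
  have hc2 : min (2 / m) 1 = 1 := min_eq_right ((le_div_iff₀ hm).2 (by linarith))
  have hw : ∀ b c : Bool, weight ![b, c] = b.toNat + c.toNat := fun b c => by simp [weight]
  have hz : zeros 2 = ![false, false] := (zeros 2).eq_two
  have hx : ∀ b c b' c' : Bool, ![b, c] ^^^ ![b', c'] = ![b ^^ b', c ^^ c'] :=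
    fun b c b' c' => eq_two _
  have hd : ∀ b c b' c' : Bool, ![b, c] &&& ![b', c'] = ![b && b', c && c'] :=
    fun b c b' c' => eq_two _
  have he : ∀ b c : Bool, errorWeight ε ![b, c] =
    (if b then ε else 1 - ε) * (if c then ε else 1 - ε) := fun b c => by
    rw [errorWeight, Fin.prod_univ_two]; rfl
  have ho : ∀ b c b' c' : Bool, ofWeights k ![b, c] ![b', c'] =
      if (b && b') = false ∧ (c && c') = false then k (b.toNat + c.toNat) (b'.toNat + c'.toNat)
        else 0 := fun b c b' c' => by
    simp only [ofWeights, hd, hz, hw]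
    congr 1
    simp [funext_iff, Fin.forall_fin_two]
  refine isGuessingProb_abns_of_weights hε hε0 hε1 hm k ?_ hk ?_ ?_ ?_ ?_ ?_
  · rw [← hg]
    simp [sum_two, hw, he, hc2, ← hc]
    ring
  · refine forall_two fun b c => ?_
    simp only [sum_two, ho, he]
    cases b <;> cases c <;> simp <;> linarith
  · refine forall_two fun b c => ?_
    simp only [sum_two, hx, ho]
    cases b <;> cases c <;> simp <;> linarith
  · refine forall_two fun b c => ?_
    simp only [sum_two, ho, he, hz]
    cases b <;> cases c <;> simp <;> linarith
  · simp only [sum_two, ho, he, hz]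
    simp
    linarith
  · simp only [sum_two, ho, he, hz]
    simp
    linarith

theorem isGuessingProb_three_abns_of_weights {ε m c d : ℝ} (hε : (1 - v) / 4 = ε) (hε0 : 0 ≤ ε)
    (hε1 : ε ≤ 1) (hm : 0 < m) (hm3 : m ≤ 3) (hc : min (1 / m) 1 = c) (hd : min (2 / m) 1 = d)
    (k : ℕ → ℕ → ℝ)
    (hg : 1 - (3 * c + 3 * d + 1) / 8 +
      2 * (3 * c * (ε * (1 - ε) ^ 2) + 3 * d * (ε ^ 2 * (1 - ε)) + ε ^ 3) = g)
    (hk : ∀ i j, 0 ≤ k i j)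
    (hke0 : k 0 0 + 3 * k 1 0 + 3 * k 2 0 + k 3 0 = (1 - ε) ^ 3)
    (hke1 : k 0 1 + 2 * k 1 1 + k 2 1 = ε * (1 - ε) ^ 2)
    (hke2 : k 0 2 + k 1 2 = ε ^ 2 * (1 - ε)) (hke3 : k 0 3 = ε ^ 3)
    (hka0 : k 0 0 = 1 / 8) (hka1 : k 0 1 + k 1 0 = 1 / 8)
    (hka2 : k 0 2 + 2 * k 1 1 + k 2 0 = 1 / 8)
    (hkb1 : ε * (1 - ε) ^ 2 ≤ k 1 0 + 2 * k 1 1 + k 1 2)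
    (hkb2 : ε ^ 2 * (1 - ε) ≤ k 2 0 + k 2 1) (hkb3 : ε ^ 3 ≤ k 3 0)
    (hg0 : k 0 0 + 3 * k 0 1 + 3 * k 0 2 + k 0 3 + 1 - (1 - ε) ^ 3 = g) :
    IsGuessingProb (n := 3) ABNS v g := by
  have hc3 : min (3 / m) 1 = 1 := min_eq_right ((le_div_iff₀ hm).2 (by linarith))
  have hw : ∀ b c d : Bool, weight ![b, c, d] = b.toNat + c.toNat + d.toNat :=
    fun b c d => by simp [weight, Fin.sum_univ_three]
  have hz : zeros 3 = ![false, false, false] := (zeros 3).eq_three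
  have hx : ∀ b c d b' c' d' : Bool, ![b, c, d] ^^^ ![b', c', d'] =
    ![b ^^ b', c ^^ c', d ^^ d'] := fun b c d b' c' d' => eq_three _
  have hd : ∀ b c d b' c' d' : Bool, ![b, c, d] &&& ![b', c', d'] =
    ![b && b', c && c', d && d'] := fun b c d b' c' d' => eq_three _
  have he : ∀ b c d : Bool, errorWeight ε ![b, c, d] =
    (if b then ε else 1 - ε) * (if c then ε else 1 - ε) * (if d then ε else 1 - ε) :=
    fun b c d => by rw [errorWeight, Fin.prod_univ_three]; rfl
  have ho : ∀ b c d b' c' d' : Bool, ofWeights k ![b, c, d] ![b', c', d'] =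
      if (b && b') = false ∧ (c && c') = false ∧ (d && d') = false then
        k (b.toNat + c.toNat + d.toNat) (b'.toNat + c'.toNat + d'.toNat)
        else 0 := fun b c d b' c' d' => by
    simp only [ofWeights, hd, hz, hw]
    congr 1
    simp [funext_iff, Fin.forall_fin_succ]
  refine isGuessingProb_abns_of_weights hε hε0 hε1 hm k ?_ hk ?_ ?_ ?_ ?_ ?_
  · rw [← hg]
    simp [sum_three, hw, he, hc3, ← hc, ← ‹_ = d›]
    ring
  · refine forall_three fun b c d => ?_
    simp only [sum_three, ho, he]
    cases b <;> cases c <;> cases d <;> simp <;> linarith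
  · refine forall_three fun b c d => ?_
    simp only [sum_three, hx, ho]
    cases b <;> cases c <;> cases d <;> simp <;> linarith
  · refine forall_three fun b c d => ?_
    simp only [sum_three, ho, he, hz]
    cases b <;> cases c <;> cases d <;> simp <;> linarith
  · simp only [sum_three, ho, he, hz]
    simp
    linarith
  · simp only [sum_three, ho, he, hz]
    simp
    linarith

end ABNSGuessing

/-! ### The noise regimes under ABNS -/

section ABNSRegimes

/-- The optimal coupling for two copies at large noise. -/
noncomputable def twoHighNoise (ε : ℝ) : ℕ → ℕ → ℝ
  | 0, 0 => 1 / 4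
  | 0, 1 => 1 / 8
  | 0, 2 => ε ^ 2
  | 1, 0 => 1 / 8
  | 1, 1 => ε - ε ^ 2 - 1 / 8
  | 2, 0 => 1 / 2 - 2 * ε + ε ^ 2
  | _, _ => 0

/-- The optimal coupling for two copies at small noise. -/
noncomputable def twoLowNoise (ε : ℝ) : ℕ → ℕ → ℝ
  | 0, 0 => 1 / 4
  | 0, 1 => ε * (1 - ε)
  | 0, 2 => ε ^ 2
  | 1, 0 => 1 / 4 - ε * (1 - ε)
  | 2, 0 => 1 / 4 - ε ^ 2
  | _, _ => 0

/-- The optimal coupling for three copies at large noise. -/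
noncomputable def threeHighNoise (ε : ℝ) : ℕ → ℕ → ℝ
  | 0, 0 => 1 / 8
  | 0, 1 => 1 / 8 - ε * (1 - ε ^ 2) / 3
  | 0, 2 => ε ^ 2 * (1 - ε)
  | 0, 3 => ε ^ 3
  | 1, 0 => ε * (1 - ε ^ 2) / 3
  | 1, 1 => ε * (1 - ε) * (1 - 2 * ε) / 3
  | 2, 0 => 1 / 8 - 2 / 3 * ε + ε ^ 2 - ε ^ 3 / 3
  | 2, 1 => 2 / 3 * (ε - ε ^ 3) - 1 / 8
  | 3, 0 => 1 / 2 - 2 * ε + ε ^ 3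
  | _, _ => 0

/-- The optimal coupling for three copies at intermediate noise. -/
noncomputable def threeMediumNoise (ε : ℝ) : ℕ → ℕ → ℝ
  | 0, 0 => 1 / 8
  | 0, 1 => 1 / 16
  | 0, 2 => ε ^ 2 * (1 - ε)
  | 0, 3 => ε ^ 3
  | 1, 0 => 1 / 16
  | 1, 1 => ε * (1 - ε) ^ 2 / 2 - 1 / 32
  | 2, 0 => 3 / 16 - ε + ε ^ 2
  | 3, 0 => 1 / 8 - ε ^ 3
  | _, _ => 0

/-- The optimal coupling for three copies at small noise. -/
noncomputable def threeLowNoise (ε : ℝ) : ℕ → ℕ → ℝ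
  | 0, 0 => 1 / 8
  | 0, 1 => ε * (1 - ε) ^ 2
  | 0, 2 => ε ^ 2 * (1 - ε)
  | 0, 3 => ε ^ 3
  | 1, 0 => 1 / 8 - ε * (1 - ε) ^ 2
  | 2, 0 => 1 / 8 - ε ^ 2 * (1 - ε)
  | 3, 0 => 1 / 8 - ε ^ 3
  | _, _ => 0

variable {v : ℝ}

/-- The threshold is `ε (1 - ε) = 1/8`. Above it the entry `(1, 1)` of `twoHighNoise` is
nonnegative; below it Bob's law in `twoLowNoise` dominates the error law at weight one. -/
theorem isGuessingProb_two_abns_of_le (hv : v ∈ Set.Icc (0 : ℝ) 1) (h : v ≤ √2 - 1) :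
    IsGuessingProb (n := 2) ABNS v (1 - 1 / 2 * v) := by
  obtain ⟨hv0, hv1⟩ := hv
  have hq : v ^ 2 + 2 * v ≤ 1 := by
    nlinarith [Real.sq_sqrt (show (0 : ℝ) ≤ 2 by norm_num), Real.sqrt_nonneg 2]
  obtain ⟨ε, rfl⟩ : ∃ ε, v = 1 - 4 * ε := ⟨(1 - v) / 4, by ring⟩
  have hε0 : 0 ≤ ε := by linarith
  have hε4 : ε ≤ 1 / 4 := by linarith
  refine isGuessingProb_two_abns_of_weights (ε := ε) (m := 2) (c := 1 / 2) (by ring) hε0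
    (by linarith) two_pos le_rfl (by norm_num) (twoHighNoise ε) ?_ ?_ ?_ ?_ ?_ ?_ ?_ ?_ ?_ ?_
  · ring
  · rintro (_ | _ | _ | i) (_ | _ | _ | j) <;> simp only [twoHighNoise] <;> nlinarith
  all_goals norm_num [twoHighNoise]
  all_goals nlinarith

theorem isGuessingProb_two_abns_of_ge (hv : v ∈ Set.Icc (0 : ℝ) 1) (h : √2 - 1 ≤ v) :
    IsGuessingProb (n := 2) ABNS v (9 / 8 - 3 / 4 * v - 1 / 8 * v ^ 2) := by
  obtain ⟨hv0, hv1⟩ := hv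
  have hq : 1 ≤ v ^ 2 + 2 * v := by
    nlinarith [Real.sq_sqrt (show (0 : ℝ) ≤ 2 by norm_num), Real.sqrt_nonneg 2]
  obtain ⟨ε, rfl⟩ : ∃ ε, v = 1 - 4 * ε := ⟨(1 - v) / 4, by ring⟩
  have hε0 : 0 ≤ ε := by linarith
  have hε4 : ε ≤ 1 / 4 := by linarith
  refine isGuessingProb_two_abns_of_weights (ε := ε) (m := 1) (c := 1) (by ring) hε0
    (by linarith) one_pos (by norm_num) (by norm_num) (twoLowNoise ε) ?_ ?_ ?_ ?_ ?_ ?_ ?_ ?_ ?_ ?_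
  · ring
  · rintro (_ | _ | _ | i) (_ | _ | _ | j) <;> simp only [twoLowNoise] <;> nlinarith
  all_goals norm_num [twoLowNoise]
  all_goals nlinarith

theorem isGuessingProb_three_abns_high (hv : v ∈ Set.Icc (0 : ℝ) 1)
    (h : 0 ≤ v ^ 3 - 3 * v ^ 2 - 13 * v + 3) :
    IsGuessingProb (n := 3) ABNS v (1 - 1 / 2 * v) := by
  obtain ⟨hv0, hv1⟩ := hv
  obtain ⟨ε, rfl⟩ : ∃ ε, v = 1 - 4 * ε := ⟨(1 - v) / 4, by ring⟩
  have hε0 : 0 ≤ ε := by linarith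
  have hε4 : ε ≤ 1 / 4 := by linarith
  -- This is the entry `(2, 1)`, the only one whose sign changes at the first break point.
  have h' : 0 ≤ 2 / 3 * (ε - ε ^ 3) - 1 / 8 := by linarith
  have h2 : 0 ≤ ε ^ 2 * (1 / 4 - ε) := by nlinarith
  have h3 : 0 ≤ ε ^ 3 := by positivity
  have h4 : 0 ≤ ε * (1 / 4 - ε) := by nlinarith
  refine isGuessingProb_three_abns_of_weights (ε := ε) (m := 3) (c := 1 / 3) (d := 2 / 3)
    (by ring) hε0 (by linarith) three_pos le_rfl (by norm_num) (by norm_num) (threeHighNoise ε)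
    ?_ ?_ ?_ ?_ ?_ ?_ ?_ ?_ ?_ ?_ ?_ ?_ ?_
  · ring
  · rintro (_ | _ | _ | _ | i) (_ | _ | _ | _ | j) <;> simp only [threeHighNoise] <;> nlinarith
  all_goals norm_num [threeHighNoise]
  all_goals nlinarith

theorem isGuessingProb_three_abns_medium (hv : v ∈ Set.Icc (0 : ℝ) 1)
    (h1 : v ^ 3 - 3 * v ^ 2 - 13 * v + 3 ≤ 0) (h2 : v ^ 3 + 5 * v ^ 2 + 3 * v - 5 ≤ 0) :
    IsGuessingProb (n := 3) ABNS v
      (67 / 64 - 45 / 64 * v - 3 / 64 * v ^ 2 + 1 / 64 * v ^ 3) := by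
  obtain ⟨hv0, hv1⟩ := hv
  obtain ⟨ε, rfl⟩ : ∃ ε, v = 1 - 4 * ε := ⟨(1 - v) / 4, by ring⟩
  have hε0 : 0 ≤ ε := by linarith
  have hε4 : ε ≤ 1 / 4 := by linarith
  -- Equivalent to domination of the error law at weight two, `hkb2`; the next inequality is
  -- positivity of the entry `(1, 1)`.
  have h' : 2 / 3 * (ε - ε ^ 3) - 1 / 8 ≤ 0 := by linarith
  have h'' : 0 ≤ ε * (1 - ε) ^ 2 / 2 - 1 / 32 := by linarith
  have h2 : 0 ≤ ε ^ 2 * (1 / 4 - ε) := by nlinarith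
  have h3 : 0 ≤ ε ^ 3 := by positivity
  have h4 : 0 ≤ ε * (1 / 4 - ε) := by nlinarith
  refine isGuessingProb_three_abns_of_weights (ε := ε) (m := 2) (c := 1 / 2) (d := 1)
    (by ring) hε0 (by linarith) two_pos (by norm_num) (by norm_num) (by norm_num)
    (threeMediumNoise ε) ?_ ?_ ?_ ?_ ?_ ?_ ?_ ?_ ?_ ?_ ?_ ?_ ?_
  · ring
  · rintro (_ | _ | _ | _ | i) (_ | _ | _ | _ | j) <;> simp only [threeMediumNoise] <;> nlinarith
  all_goals norm_num [threeMediumNoise]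
  all_goals nlinarith

theorem isGuessingProb_three_abns_low (hv : v ∈ Set.Icc (0 : ℝ) 1)
    (h : 0 ≤ v ^ 3 + 5 * v ^ 2 + 3 * v - 5) :
    IsGuessingProb (n := 3) ABNS v
      (41 / 32 - 27 / 32 * v - 9 / 32 * v ^ 2 - 1 / 32 * v ^ 3) := by
  obtain ⟨hv0, hv1⟩ := hv
  obtain ⟨ε, rfl⟩ : ∃ ε, v = 1 - 4 * ε := ⟨(1 - v) / 4, by ring⟩
  have hε0 : 0 ≤ ε := by linarith
  have hε4 : ε ≤ 1 / 4 := by linarith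
  -- Equivalent to domination of the error law at weight one, `hkb1`.
  have h'' : ε * (1 - ε) ^ 2 / 2 - 1 / 32 ≤ 0 := by linarith
  have h2 : 0 ≤ ε ^ 2 * (1 / 4 - ε) := by nlinarith
  have h3 : 0 ≤ ε ^ 3 := by positivity
  have h4 : 0 ≤ ε * (1 / 4 - ε) := by nlinarith
  refine isGuessingProb_three_abns_of_weights (ε := ε) (m := 1) (c := 1) (d := 1)
    (by ring) hε0 (by linarith) one_pos (by norm_num) (by norm_num) (by norm_num)
    (threeLowNoise ε) ?_ ?_ ?_ ?_ ?_ ?_ ?_ ?_ ?_ ?_ ?_ ?_ ?_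
  · ring
  · rintro (_ | _ | _ | _ | i) (_ | _ | _ | _ | j) <;> simp only [threeLowNoise] <;> nlinarith
  all_goals norm_num [threeLowNoise]
  all_goals nlinarith

end ABNSRegimes

/-! ### Splitting off the last round -/

section Push

variable {n : ℕ}

/-- Append a bit to a string. -/
def push (s : BitString n) (c : Bool) : BitString (n + 1) := Fin.snoc (α := fun _ => Bool) s c

@[simp] theorem push_castSucc (s : BitString n) (c : Bool) (i : Fin n) :
    push s c i.castSucc = s i :=
  Fin.snoc_castSucc (α := fun _ => Bool) ..

@[simp] theorem push_last (s : BitString n) (c : Bool) : push s c (Fin.last n) = c :=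
  Fin.snoc_last (α := fun _ => Bool) ..

theorem push_ext {s t : BitString (n + 1)} (h : ∀ i : Fin n, s i.castSucc = t i.castSucc)
    (h' : s (Fin.last n) = t (Fin.last n)) : s = t :=
  funext fun i => Fin.lastCases h' h i

theorem push_eta (s : BitString (n + 1)) :
    push (fun i => s i.castSucc) (s (Fin.last n)) = s :=
  push_ext (by simp) (by simp)

theorem forall_push {p : BitString (n + 1) → Prop} (h : ∀ s c, p (push s c)) (s) : p s :=
  push_eta s ▸ h _ _

theorem push_xor_push (s t : BitString n) (c d : Bool) :
    push s c ^^^ push t d = push (s ^^^ t) (c ^^ d) :=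
  push_ext (by simp) (by simp)

theorem push_and_push (s t : BitString n) (c d : Bool) :
    push s c &&& push t d = push (s &&& t) (c && d) :=
  push_ext (by simp) (by simp)

theorem push_zeros : push (zeros n) false = zeros (n + 1) :=
  push_ext (by simp) (by simp)

theorem sum_push {M : Type*} [AddCommMonoid M] (f : BitString (n + 1) → M) :
    ∑ s, f s = ∑ s, (f (push s false) + f (push s true)) := by
  rw [← (Fin.snocEquiv fun _ : Fin (n + 1) => Bool).sum_comp, Fintype.sum_prod_type_right]
  refine Finset.sum_congr rfl fun s _ => ?_
  rw [Fintype.sum_bool, add_comm]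
  rfl

theorem errorWeight_push (ε : ℝ) (e : BitString n) (c : Bool) :
    errorWeight ε (push e c) = errorWeight ε e * if c then ε else 1 - ε := by
  simp [errorWeight, Fin.prod_univ_castSucc]

theorem agreeUpTo_push {i : ℕ} (hi : i ≤ n) {s t : BitString n} {c d : Bool} :
    AgreeUpTo i (push s c) (push t d) ↔ AgreeUpTo i s t := by
  refine ⟨fun h k hk => by simpa using h k.castSucc hk, fun h k => Fin.lastCases ?_ ?_ k⟩
  · intro hk
    simp at hk
    omega
  · intro k hk
    simpa using h k hk

theorem agreeUpTo_self {s t : BitString n} : AgreeUpTo n s t ↔ s = t :=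
  ⟨fun h => funext fun k => h k k.2, fun h => h ▸ AgreeUpTo.refl n s⟩

theorem agreeUpTo_succ_push {s t : BitString n} {c d : Bool} :
    AgreeUpTo (n + 1) (push s c) (push t d) ↔ AgreeUpTo n s t ∧ c = d := by
  rw [agreeUpTo_self, agreeUpTo_self]
  refine ⟨fun h => ⟨funext fun i => by simpa using congrFun h i.castSucc,
    by simpa using congrFun h (Fin.last n)⟩, fun h => by rw [h.1, h.2]⟩

/-- The marginal of the first `n` rounds, with the last inputs set to zero. -/
noncomputable def truncate (P : Table (n + 1)) : Table n := fun a b x y =>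
  ∑ a', ∑ b', P (push a a') (push b b') (push x false) (push y false)

theorem prefixMarginal_push_of_le (P : Table (n + 1)) {i j : ℕ} (hi : i ≤ n) (hj : j ≤ n)
    (a b x y : BitString n) (a₀ b₀ x₀ y₀ : Bool) :
    prefixMarginal P i j (push a a₀) (push b b₀) (push x x₀) (push y y₀) =
      prefixMarginal (fun a b x y => ∑ a', ∑ b', P (push a a') (push b b') (push x x₀)
        (push y y₀)) i j a b x y := by
  simp only [prefixMarginal, sum_push, agreeUpTo_push hi, agreeUpTo_push hj, Fintype.sum_bool]
  refine Finset.sum_congr rfl fun a' _ => ?_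
  rw [← Finset.sum_add_distrib]
  refine Finset.sum_congr rfl fun b' _ => ?_
  split_ifs <;> ring

theorem prefixMarginal_push_right (P : Table (n + 1)) {i : ℕ} (hi : i ≤ n)
    (a b x y : BitString n) (a₀ b₀ x₀ y₀ : Bool) :
    prefixMarginal P i (n + 1) (push a a₀) (push b b₀) (push x x₀) (push y y₀) =
      prefixMarginal (fun a b x y => ∑ a', P (push a a') (push b b₀) (push x x₀)
        (push y y₀)) i n a b x y := by
  simp only [prefixMarginal, sum_push, agreeUpTo_push hi, agreeUpTo_succ_push, Fintype.sum_bool]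
  refine Finset.sum_congr rfl fun a' _ => ?_
  rw [← Finset.sum_add_distrib]
  refine Finset.sum_congr rfl fun b' _ => ?_
  by_cases h : AgreeUpTo i a a' ∧ AgreeUpTo n b b'
  · cases b₀ <;> simp [h] <;> ring
  · cases b₀ <;> simp [h]

theorem prefixMarginal_push_left (P : Table (n + 1)) {j : ℕ} (hj : j ≤ n)
    (a b x y : BitString n) (a₀ b₀ x₀ y₀ : Bool) :
    prefixMarginal P (n + 1) j (push a a₀) (push b b₀) (push x x₀) (push y y₀) =
      prefixMarginal (fun a b x y => ∑ b', P (push a a₀) (push b b') (push x x₀)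
        (push y y₀)) n j a b x y := by
  simp only [prefixMarginal, sum_push, agreeUpTo_push hj, agreeUpTo_succ_push, Fintype.sum_bool]
  refine Finset.sum_congr rfl fun a' _ => ?_
  rw [← Finset.sum_add_distrib]
  refine Finset.sum_congr rfl fun b' _ => ?_
  by_cases h : AgreeUpTo n a a' ∧ AgreeUpTo j b b'
  · cases a₀ <;> simp [h] <;> ring
  · cases a₀ <;> simp [h]

theorem prefixMarginal_self (P : Table n) (a b x y : BitString n) :
    prefixMarginal P n n a b x y = P a b x y := by
  simp only [prefixMarginal, agreeUpTo_self]
  rw [Finset.sum_eq_single a, Finset.sum_eq_single b] <;> simp +contextual [eq_comm]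

end Push

/-! ### One-round inequalities under weak time-ordered no-signaling -/

section WTONSUpperBound

variable {n : ℕ}

theorem WTONS.sum_alice {P : Table (n + 1)} (h : WTONS P) (a b x y : BitString n)
    (b₀ x₀ x₁ y₀ : Bool) :
    ∑ a', P (push a a') (push b b₀) (push x x₀) (push y y₀) =
      ∑ a', P (push a a') (push b b₀) (push x x₁) (push y y₀) := by
  have := (h n n.lt_succ_self).1 (push a false) (push b b₀) (push x x₀) (push x x₁)
    (push y y₀) (push y y₀) ((agreeUpTo_push le_rfl).2 (AgreeUpTo.refl _ _)) (AgreeUpTo.refl _ _)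
  rwa [prefixMarginal_push_right P le_rfl, prefixMarginal_push_right P le_rfl,
    prefixMarginal_self, prefixMarginal_self] at this

theorem WTONS.sum_bob {P : Table (n + 1)} (h : WTONS P) (a b x y : BitString n)
    (a₀ x₀ y₀ y₁ : Bool) :
    ∑ b', P (push a a₀) (push b b') (push x x₀) (push y y₀) =
      ∑ b', P (push a a₀) (push b b') (push x x₀) (push y y₁) := by
  have := (h n n.lt_succ_self).2 (push a a₀) (push b false) (push x x₀) (push x x₀)
    (push y y₀) (push y y₁) (AgreeUpTo.refl _ _) ((agreeUpTo_push le_rfl).2 (AgreeUpTo.refl _ _))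
  rwa [prefixMarginal_push_left P le_rfl, prefixMarginal_push_left P le_rfl,
    prefixMarginal_self, prefixMarginal_self] at this

theorem WTONS.truncate {P : Table (n + 1)} (h : WTONS P) : WTONS (truncate P) := by
  intro i hi
  constructor
  · intro a b x x' y y' hx hy
    have := (h i (by omega)).1 (push a false) (push b false) (push x false) (push x' false)
      (push y false) (push y' false) ((agreeUpTo_push hi.le).2 hx) ((agreeUpTo_push hi).2 hy)
    rwa [prefixMarginal_push_of_le P hi.le hi, prefixMarginal_push_of_le P hi.le hi] at this
  · intro a b x x' y y' hx hy
    have := (h i (by omega)).2 (push a false) (push b false) (push x false) (push x' false)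
      (push y false) (push y' false) ((agreeUpTo_push hi).2 hx) ((agreeUpTo_push hi.le).2 hy)
    rwa [prefixMarginal_push_of_le P hi hi.le, prefixMarginal_push_of_le P hi hi.le] at this

theorem truncate_nonneg {P : Table (n + 1)} (h : ∀ a b x y, 0 ≤ P a b x y) (a b x y : BitString n) :
    0 ≤ truncate P a b x y :=
  Finset.sum_nonneg fun _ _ => Finset.sum_nonneg fun _ _ => h _ _ _ _

theorem HasErrorLaw.truncate {ε : ℝ} {P : Table (n + 1)} (h : HasErrorLaw ε P) :
    HasErrorLaw ε (truncate P) := by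
  intro e x y
  have h0 := h (push e false) (push x false) (push y false)
  have h1 := h (push e true) (push x false) (push y false)
  rw [errorWeight_push, if_neg Bool.false_ne_true, sum_push] at h0
  rw [errorWeight_push, if_pos rfl, sum_push] at h1
  simp only [push_and_push, push_xor_push] at h0 h1
  have h2 : errorWeight ε e = errorWeight ε e * (1 - ε) + errorWeight ε e * ε := by ring
  rw [h2, ← h0, ← h1, ← Finset.sum_add_distrib]
  refine Finset.sum_congr rfl fun a _ => ?_
  simp [_root_.truncate]
  ring

/-- The probability that Alice's outputs vanish when all inputs vanish, weighted by a function of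
the error string. -/
noncomputable def weightedZeroProb (P : Table n) (f : BitString n → ℝ) : ℝ :=
  ∑ b, f b * P (zeros n) b (zeros n) (zeros n)

theorem weightedZeroProb_add (P : Table n) (f g : BitString n → ℝ) :
    weightedZeroProb P (fun e => f e + g e) = weightedZeroProb P f + weightedZeroProb P g := by
  simp only [weightedZeroProb, add_mul, Finset.sum_add_distrib]

/-- The probability, weighted by a function of the previous error string, that the last round is
wrong and Alice's previous outputs vanish, when the previous inputs vanish. -/
noncomputable def lastErrorProb (P : Table (n + 1)) (f : BitString n → ℝ) (x₀ y₀ : Bool) : ℝ :=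
  ∑ b, f b * ∑ a', P (push (zeros n) a') (push b (a' ^^ !(x₀ && y₀))) (push (zeros n) x₀)
    (push (zeros n) y₀)

/-- When Alice's previous outputs and the previous inputs vanish, Bob's outputs are the error
string. The bound discards all histories with other outputs of Alice. -/
theorem HasErrorLaw.lastErrorProb_le {ε : ℝ} {P : Table (n + 1)} (h : HasErrorLaw ε P)
    (hP : ∀ a b x y, 0 ≤ P a b x y) {f : BitString n → ℝ} (hf : ∀ e, 0 ≤ f e) (x₀ y₀ : Bool) :
    lastErrorProb P f x₀ y₀ ≤ ε * ∑ e, f e * errorWeight ε e := by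
  rw [lastErrorProb, Finset.mul_sum]
  refine Finset.sum_le_sum fun e _ => ?_
  have h1 := h (push e true) (push (zeros n) x₀) (push (zeros n) y₀)
  rw [errorWeight_push, if_pos rfl, sum_push] at h1
  calc _ ≤ f e * (errorWeight ε e * ε) := ?_
    _ = _ := by ring
  refine mul_le_mul_of_nonneg_left ?_ (hf e)
  rw [← h1, Fintype.sum_bool]
  refine le_trans (le_of_eq ?_) (Finset.single_le_sum
    (fun a _ => add_nonneg (hP _ _ _ _) (hP _ _ _ _)) (Finset.mem_univ (zeros n)))
  simp only [push_xor_push, push_and_push, zeros_bxor, zeros_and, bxor_zeros]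
  rw [add_comm]
  cases x₀ <;> cases y₀ <;> rfl

/-- The trivial bound: the last output is ignored. -/
theorem weightedZeroProb_push_le_truncate {P : Table (n + 1)}
    (hP : ∀ a b x y, 0 ≤ P a b x y) {f : BitString n → ℝ} (hf : ∀ e, 0 ≤ f e)
    {g : BitString (n + 1) → ℝ} (hg : ∀ e c, g (push e c) = f e) :
    weightedZeroProb P g ≤ weightedZeroProb (truncate P) f := by
  simp only [weightedZeroProb, sum_push, hg, ← push_zeros]
  refine Finset.sum_le_sum fun b _ => ?_
  rw [← mul_add]
  refine mul_le_mul_of_nonneg_left ?_ (hf b)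
  simp only [truncate, Fintype.sum_bool]
  linarith [hP (push (zeros n) true) (push b true) (push (zeros n) false) (push (zeros n) false),
    hP (push (zeros n) true) (push b false) (push (zeros n) false) (push (zeros n) false)]

/-- In a no-signaling box, the excess of the probability that Alice's output vanishes over one half
is at most half the sum of the error probabilities over all inputs. -/
theorem box_le {B : Bool → Bool → Bool → Bool → ℝ} (h0 : ∀ a b x y, 0 ≤ B a b x y)
    (hA : ∀ a x y y', ∑ b, B a b x y = ∑ b, B a b x y')
    (hB : ∀ b x x' y, ∑ a, B a b x y = ∑ a, B a b x' y) :
    B false false false false + B false true false false ≤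
      (∑ a, ∑ b, B a b false false) / 2 + (∑ a, B a (a ^^ !(false && false)) false false +
        ∑ a, B a (a ^^ !(false && true)) false true + ∑ a, B a (a ^^ !(true && false)) true false +
        ∑ a, B a (a ^^ !(true && true)) true true) / 2 := by
  simp only [Fintype.sum_bool, Bool.and_self, Bool.and_false, Bool.and_true, Bool.not_true,
    Bool.not_false, Bool.xor_false, Bool.xor_true] at *
  linarith [hA false false false true, hA false true false true, hA true false false true,
    hA true true false true, hB false false true false, hB false false true true,
    hB true false true false, hB true false true true, h0 false true false false,
    h0 true false false false, h0 false true false true, h0 true false false true,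
    h0 false true true false, h0 true false true false, h0 false false true true,
    h0 true true true true]

/-- Go around the cycle `x = 0`, `y = 0`, `x = 1`, `y = 1`, `x = 0`. Without errors the outputs are
equal along each edge except the edge `(1, 1)`, so `a = 0` would turn into `a = 1`; hence `P(a = 0)
- P(a = 1)` at `x = 0` is at most the sum of one error term per edge. The term of the edge `(0, 0)`
is the outcome `a = 0`, `b = 1`, and half of it is moved to the left. -/
theorem box_half_le {B : Bool → Bool → Bool → Bool → ℝ} (h0 : ∀ a b x y, 0 ≤ B a b x y)
    (hA : ∀ a x y y', ∑ b, B a b x y = ∑ b, B a b x y')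
    (hB : ∀ b x x' y, ∑ a, B a b x y = ∑ a, B a b x' y) :
    B false false false false + 1 / 2 * B false true false false ≤
      (∑ a, ∑ b, B a b false false) / 2 +
        (∑ a, B a (a ^^ !(false && true)) false true + ∑ a, B a (a ^^ !(true && false)) true false +
        ∑ a, B a (a ^^ !(true && true)) true true) / 2 := by
  simp only [Fintype.sum_bool, Bool.and_self, Bool.and_false, Bool.and_true, Bool.not_true,
    Bool.not_false, Bool.xor_false, Bool.xor_true] at *
  linarith [hA false false false true, hA false true false true, hA true false false true,
    hA true true false true, hB false false true false, hB false false true true,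
    hB true false true false, hB true false true true, h0 false true false false,
    h0 true false false false, h0 false true false true, h0 true false false true,
    h0 false true true false, h0 true false true false, h0 false false true true,
    h0 true true true true]

/-- For each previous `b`, with Alice's previous outputs and all previous inputs zero, the last
round is an unnormalized no-signaling box, to which `box_le` applies. -/
theorem WTONS.weightedZeroProb_push_le {ε : ℝ} {P : Table (n + 1)} (h : WTONS P)
    (hP : ∀ a b x y, 0 ≤ P a b x y) (hE : HasErrorLaw ε P) {f : BitString n → ℝ}
    (hf : ∀ e, 0 ≤ f e) {g : BitString (n + 1) → ℝ} (hg : ∀ e c, g (push e c) = f e) :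
    weightedZeroProb P g ≤ weightedZeroProb (_root_.truncate P) f / 2 +
      2 * ε * ∑ e, f e * errorWeight ε e := by
  suffices weightedZeroProb P g ≤ weightedZeroProb (_root_.truncate P) f / 2 +
      (lastErrorProb P f false false +
        lastErrorProb P f false true +
        lastErrorProb P f true false +
        lastErrorProb P f true true) / 2 by
    linarith [hE.lastErrorProb_le hP hf false false,
      hE.lastErrorProb_le hP hf false true,
      hE.lastErrorProb_le hP hf true false,
      hE.lastErrorProb_le hP hf true true]
  simp only [weightedZeroProb, lastErrorProb, sum_push, hg, ← push_zeros, ← Finset.sum_add_distrib,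
    Finset.sum_div]
  refine Finset.sum_le_sum fun b _ => ?_
  rw [← mul_add, ← mul_add, ← mul_add, ← mul_add, mul_div_assoc, mul_div_assoc, ← mul_add]
  exact mul_le_mul_of_nonneg_left (box_le
    (B := fun a b' x y => P (push (zeros n) a) (push b b') (push (zeros n) x) (push (zeros n) y))
    (fun _ _ _ _ => hP _ _ _ _) (fun _ _ _ _ => h.sum_bob _ _ _ _ _ _ _ _)
    (fun _ _ _ _ => h.sum_alice (zeros n) _ _ _ _ _ _ _)) (hf b)

theorem WTONS.weightedZeroProb_push_half_le {ε : ℝ} {P : Table (n + 1)} (h : WTONS P)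
    (hP : ∀ a b x y, 0 ≤ P a b x y) (hE : HasErrorLaw ε P) {f : BitString n → ℝ}
    (hf : ∀ e, 0 ≤ f e) {g : BitString (n + 1) → ℝ} (hg0 : ∀ e, g (push e false) = f e)
    (hg1 : ∀ e, g (push e true) = f e / 2) :
    weightedZeroProb P g ≤ weightedZeroProb (_root_.truncate P) f / 2 +
      3 / 2 * ε * ∑ e, f e * errorWeight ε e := by
  suffices weightedZeroProb P g ≤ weightedZeroProb (_root_.truncate P) f / 2 +
      (lastErrorProb P f false true +
        lastErrorProb P f true false +
        lastErrorProb P f true true) / 2 by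
    linarith [hE.lastErrorProb_le hP hf false true,
      hE.lastErrorProb_le hP hf true false,
      hE.lastErrorProb_le hP hf true true]
  simp only [weightedZeroProb, lastErrorProb, sum_push, hg0, hg1, ← push_zeros, ← Finset.sum_add_distrib,
    Finset.sum_div]
  refine Finset.sum_le_sum fun b _ => ?_
  rw [← mul_add, ← mul_add, mul_div_assoc, mul_div_assoc, ← mul_add, ← mul_one_div, mul_assoc,
    ← mul_add]
  exact mul_le_mul_of_nonneg_left (box_half_le
    (B := fun a b' x y => P (push (zeros n) a) (push b b') (push (zeros n) x) (push (zeros n) y))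
    (fun _ _ _ _ => hP _ _ _ _) (fun _ _ _ _ => h.sum_bob _ _ _ _ _ _ _ _)
    (fun _ _ _ _ => h.sum_alice (zeros n) _ _ _ _ _ _ _)) (hf b)

end WTONSUpperBound

/-! ### Upper bounds for two and three rounds -/

section WTONSBounds

theorem HasErrorLaw.weightedZeroProb_zero {ε : ℝ} {P : Table 0} (h : HasErrorLaw ε P)
    (f : BitString 0 → ℝ) : weightedZeroProb P f = f (zeros 0) := by
  have h0 := h (zeros 0) (zeros 0) (zeros 0)
  rw [Fintype.sum_subsingleton _ (zeros 0), Subsingleton.elim (zeros 0 ^^^ _ ^^^ _) (zeros 0),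
    errorWeight, Fin.prod_univ_zero] at h0
  rw [weightedZeroProb, Fintype.sum_subsingleton _ (zeros 0), h0, mul_one]

theorem zeroProb_eq_weightedZeroProb {n : ℕ} (P : Table n) :
    zeroProb P = weightedZeroProb P fun _ => 1 := by
  simp [zeroProb, weightedZeroProb]

variable {ε : ℝ}

theorem WTONS.weightedZeroProb_succ_le {n : ℕ} {P : Table (n + 1)} (h : WTONS P)
    (hP : ∀ a b x y, 0 ≤ P a b x y) (hE : HasErrorLaw ε P) :
    zeroProb P ≤ zeroProb (_root_.truncate P) / 2 + 2 * ε := by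
  have := h.weightedZeroProb_push_le hP hE (f := fun _ => 1) (fun _ => zero_le_one)
    (g := fun _ => 1) fun _ _ => rfl
  simp only [one_mul, sum_errorWeight, mul_one] at this
  rwa [zeroProb_eq_weightedZeroProb, zeroProb_eq_weightedZeroProb]

theorem WTONS.zeroProb_two_le {P : Table 2} (h : WTONS P) (hP : ∀ a b x y, 0 ≤ P a b x y)
    (hE : HasErrorLaw ε P) : zeroProb P ≤ 1 / 4 + 3 * ε := by
  have h2 := h.weightedZeroProb_succ_le hP hE
  have h1 := h.truncate.weightedZeroProb_succ_le (truncate_nonneg hP) hE.truncate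
  rw [zeroProb_eq_weightedZeroProb (_root_.truncate (_root_.truncate P)),
    hE.truncate.truncate.weightedZeroProb_zero] at h1
  linarith

theorem WTONS.zeroProb_three_le {P : Table 3} (h : WTONS P) (hP : ∀ a b x y, 0 ≤ P a b x y)
    (hE : HasErrorLaw ε P) : zeroProb P ≤ 1 / 8 + 7 / 2 * ε := by
  have h3 := h.weightedZeroProb_succ_le hP hE
  have h2 := h.truncate.zeroProb_two_le (truncate_nonneg hP) hE.truncate
  linarith

theorem sum_errorWeight_one (f : BitString 1 → ℝ) :
    ∑ e, f e * errorWeight ε e =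
      f (push (zeros 0) false) * (1 - ε) + f (push (zeros 0) true) * ε := by
  rw [sum_push, Fintype.sum_unique]
  simp only [errorWeight_push]
  simp [errorWeight]
  rfl

theorem sum_errorWeight_two (f : BitString 2 → ℝ) :
    ∑ e, f e * errorWeight ε e =
      f (push (push (zeros 0) false) false) * ((1 - ε) * (1 - ε)) +
      f (push (push (zeros 0) false) true) * ((1 - ε) * ε) +
      (f (push (push (zeros 0) true) false) * (ε * (1 - ε)) +
      f (push (push (zeros 0) true) true) * (ε * ε)) := by
  rw [sum_push, sum_push, Fintype.sum_unique]
  simp only [errorWeight_push]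
  simp [errorWeight]
  rfl

/-- The trivial bound keeps weight one on histories with two correct rounds, and the box bound
halves the others. Going back, each round sees weight one for a correct bit and one half for an
error as long as no error has occurred, which is the situation of `box_half_le`; after an error the
weight no longer depends on the bit. -/
theorem WTONS.zeroProb_three_le' {P : Table 3} (h : WTONS P) (hP : ∀ a b x y, 0 ≤ P a b x y)
    (hE : HasErrorLaw ε P) :
    zeroProb P ≤ 1 / 4 + 9 / 4 * ε + 7 / 2 * ε ^ 2 - 2 * ε ^ 3 := by
  -- the third round, split according to whether the first two rounds are correct
  have split3 : weightedZeroProb P (fun _ => 1) =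
      weightedZeroProb P (fun e => if e 0 || e 1 then 0 else 1) +
        weightedZeroProb P (fun e => if e 0 || e 1 then 1 else 0) := by
    rw [← weightedZeroProb_add]
    congr 1
    ext e
    split_ifs <;> norm_num
  have h3a := weightedZeroProb_push_le_truncate hP
    (f := fun e : BitString 2 => if e 0 || e 1 then 0 else 1)
    (fun e => by split_ifs <;> norm_num)
    (g := fun e => if e 0 || e 1 then 0 else 1) fun e c => rfl
  have h3b := h.weightedZeroProb_push_le hP hE
    (f := fun e : BitString 2 => if e 0 || e 1 then 1 else 0)
    (fun e => by split_ifs <;> norm_num)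
    (g := fun e => if e 0 || e 1 then 1 else 0) fun e c => rfl
  -- the second round, split according to whether the first round is correct
  have split2 : weightedZeroProb (_root_.truncate P) (fun e => if e 0 || e 1 then 0 else 1) +
      weightedZeroProb (_root_.truncate P) (fun e => if e 0 || e 1 then 1 else 0) / 2 =
      weightedZeroProb (_root_.truncate P)
        (fun e => if e 0 then 0 else if e 1 then 1 / 2 else 1) +
      weightedZeroProb (_root_.truncate P) (fun e => if e 0 then 1 / 2 else 0) := by
    simp only [weightedZeroProb]
    rw [Finset.sum_div, ← Finset.sum_add_distrib, ← Finset.sum_add_distrib]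
    refine Finset.sum_congr rfl fun e _ => ?_
    cases e 0 <;> cases e 1 <;> simp <;> ring
  have h2a := h.truncate.weightedZeroProb_push_half_le (truncate_nonneg hP) hE.truncate
    (f := fun e : BitString 1 => if e 0 then 0 else 1)
    (fun e => by split_ifs <;> norm_num)
    (g := fun e => if e 0 then 0 else if e 1 then 1 / 2 else 1)
    (fun e => rfl)
    (fun e => show (if e 0 then (0 : ℝ) else 1 / 2) = (if e 0 then 0 else 1) / 2 by
      split_ifs <;> norm_num)
  have h2b := h.truncate.weightedZeroProb_push_le (truncate_nonneg hP) hE.truncate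
    (f := fun e : BitString 1 => if e 0 then 1 / 2 else 0)
    (fun e => by split_ifs <;> norm_num)
    (g := fun e => if e 0 then 1 / 2 else 0) fun e c => rfl
  -- The two second-round bounds combine to the same pattern of weights in the first round: one if
  -- correct, one half if wrong.
  have join1 : weightedZeroProb (_root_.truncate (_root_.truncate P))
      (fun e => if e 0 then 0 else 1) +
      weightedZeroProb (_root_.truncate (_root_.truncate P)) (fun e => if e 0 then 1 / 2 else 0) =
      weightedZeroProb (_root_.truncate (_root_.truncate P))
        (fun e => if e 0 then 1 / 2 else 1) := by
    rw [← weightedZeroProb_add]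
    congr 1
    ext e
    split_ifs <;> norm_num
  have h1 := h.truncate.truncate.weightedZeroProb_push_half_le
    (truncate_nonneg (truncate_nonneg hP)) hE.truncate.truncate (f := fun _ => 1)
    (fun _ => zero_le_one) (g := fun e => if e 0 then 1 / 2 else 1) (fun e => rfl) (fun e => rfl)
  rw [hE.truncate.truncate.truncate.weightedZeroProb_zero] at h1
  simp only [one_mul, sum_errorWeight] at h1
  rw [sum_errorWeight_two] at h3b
  rw [sum_errorWeight_one] at h2a h2b
  simp only [show ∀ c, push (zeros 0) c 0 = c from fun _ => rfl,
    show ∀ c d, push (push (zeros 0) c) d 0 = c from fun _ _ => rfl,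
    show ∀ c d, push (push (zeros 0) c) d 1 = d from fun _ _ => rfl] at h3b h2a h2b
  norm_num at h3b h2a h2b h1
  rw [zeroProb_eq_weightedZeroProb, split3]
  norm_num at split2 join1 h3a ⊢
  linarith

end WTONSBounds

/-! ### TONS implies WTONS -/

section TONSToWTONS

variable {n : ℕ}

theorem prefixMarginal_eq_sum_bob (P : Table n) {i j : ℕ} (a b x y : BitString n) :
    prefixMarginal P i j a b x y =
      ∑ b', if AgreeUpTo j b b' then prefixMarginal P i n a b' x y else 0 := by
  simp only [prefixMarginal, agreeUpTo_self]
  rw [Finset.sum_comm]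
  refine Finset.sum_congr rfl fun b' _ => ?_
  split_ifs with h <;> simp [h, ite_and]

theorem prefixMarginal_eq_sum_alice (P : Table n) {i j : ℕ} (a b x y : BitString n) :
    prefixMarginal P i j a b x y =
      ∑ a', if AgreeUpTo i a a' then prefixMarginal P n j a' b x y else 0 := by
  simp only [prefixMarginal, agreeUpTo_self]
  refine Finset.sum_congr rfl fun a' _ => ?_
  split_ifs with h <;> simp [h, ite_and]

theorem PrefixNoSignaling.of_total {P : Table n} {i j : ℕ} (h : PrefixNoSignaling P i n)
    (h' : PrefixNoSignaling P n j) : PrefixNoSignaling P i j := by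
  intro a b x x' y y' hx hy
  trans prefixMarginal P i j a b x' y
  · rw [prefixMarginal_eq_sum_bob, prefixMarginal_eq_sum_bob]
    simp_rw [h _ _ _ _ _ _ hx (AgreeUpTo.refl n y)]
  · rw [prefixMarginal_eq_sum_alice, prefixMarginal_eq_sum_alice]
    simp_rw [h' _ _ _ _ _ _ (AgreeUpTo.refl n x') hy]

theorem prefixNoSignaling_self (P : Table n) : PrefixNoSignaling P n n := by
  intro a b x x' y y' hx hy
  rw [agreeUpTo_self.1 hx, agreeUpTo_self.1 hy]

theorem TONS.right {P : Table n} (h : TONS P) {i : ℕ} (hi : i ≤ n) : PrefixNoSignaling P i n := by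
  rcases hi.eq_or_lt with rfl | hi
  exacts [prefixNoSignaling_self P, (h i hi).1]

theorem TONS.left {P : Table n} (h : TONS P) {i : ℕ} (hi : i ≤ n) : PrefixNoSignaling P n i := by
  rcases hi.eq_or_lt with rfl | hi
  exacts [prefixNoSignaling_self P, (h i hi).2]

theorem TONS.wtons {P : Table n} (h : TONS P) : WTONS P := fun _ hi =>
  ⟨(h.right hi.le).of_total (h.left hi), (h.right hi).of_total (h.left hi.le)⟩

end TONSToWTONS

/-! ### Extending a table by one round -/

section Extension

variable {n : ℕ}

/-- One round: a joint distribution, of total mass `W`, of Bob's output `b` and the error bit `e`,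
with error mass `D` and with mass `W / 2 + C` for `b = 0`. Alice's output `b + e` is uniform if
`t` holds and is biased towards zero otherwise. -/
noncomputable def roundKernel (t : Bool) (W C D : ℝ) (b e : Bool) : ℝ :=
  match t, b, e with
  | false, false, false => W / 2 + C
  | false, false, true => 0
  | false, true, false => W / 2 - C - D
  | false, true, true => D
  | true, false, false => (W + C - D) / 2
  | true, false, true => (C + D) / 2
  | true, true, false => (W - C - D) / 2
  | true, true, true => (D - C) / 2

/-- Whether a string is nonzero. -/
def isNonzero (x : BitString n) : Bool := decide (x ≠ zeros n)

/-- All bits of a string but the last. -/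
def pop (a : BitString (n + 1)) : BitString n := fun i => a i.castSucc

/-- Add one round to a table, with biases `C` and error masses `D` that depend on the history. -/
noncomputable def extend (P C D : Table n) : Table (n + 1) := fun a b x y =>
  roundKernel (isNonzero x) (P (pop a) (pop b) (pop x) (pop y)) (C (pop a) (pop b) (pop x) (pop y))
    (D (pop a) (pop b) (pop x) (pop y)) (b (Fin.last n))
    (a (Fin.last n) ^^ b (Fin.last n) ^^ (x (Fin.last n) && y (Fin.last n)))

/-- Multiply a table by a weight of Bob's output and the error bit of one more round. -/
noncomputable def extendMul (τ : Bool → Bool → Bool → ℝ) (D : Table n) : Table (n + 1) :=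
  fun a b x y => D (pop a) (pop b) (pop x) (pop y) * τ (isNonzero x) (b (Fin.last n))
    (a (Fin.last n) ^^ b (Fin.last n) ^^ (x (Fin.last n) && y (Fin.last n)))

@[simp] theorem pop_push (s : BitString n) (c : Bool) : pop (push s c) = s := by
  ext i; simp [pop]

theorem isNonzero_zeros : isNonzero (zeros n) = false := by simp [isNonzero]

theorem extend_push (P C D : Table n) (a b x y : BitString n) (a₀ b₀ x₀ y₀ : Bool) :
    extend P C D (push a a₀) (push b b₀) (push x x₀) (push y y₀) =
      roundKernel (isNonzero (push x x₀)) (P a b x y) (C a b x y) (D a b x y) b₀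
        (a₀ ^^ b₀ ^^ (x₀ && y₀)) := by
  simp [extend]

theorem extendMul_push (τ : Bool → Bool → Bool → ℝ) (D : Table n) (a b x y : BitString n)
    (a₀ b₀ x₀ y₀ : Bool) :
    extendMul τ D (push a a₀) (push b b₀) (push x x₀) (push y y₀) =
      D a b x y * τ (isNonzero (push x x₀)) b₀ (a₀ ^^ b₀ ^^ (x₀ && y₀)) := by
  simp [extendMul]

theorem PrefixNoSignaling.linear {P Q : Table n} {i j : ℕ} (hP : PrefixNoSignaling P i j)
    (hQ : PrefixNoSignaling Q i j) (r s : ℝ) :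
    PrefixNoSignaling (fun a b x y => r * P a b x y + s * Q a b x y) i j := by
  have := PrefixNoSignaling.sum (fun c : Bool => cond c r s) (Q := fun c => cond c P Q)
    (i := i) (j := j) (by rintro (_ | _) <;> assumption)
  simpa only [Fintype.sum_bool, cond_true, cond_false] using this

theorem prefixNoSignaling_right_of_sum {P : Table (n + 1)} {F : Bool → Table n} {i : ℕ}
    (hi : i ≤ n) (hF : ∀ c, PrefixNoSignaling (F c) i n)
    (h : ∀ a b x y b₀ x₀ y₀,
      ∑ a', P (push a a') (push b b₀) (push x x₀) (push y y₀) = F b₀ a b x y) :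
    PrefixNoSignaling P i (n + 1) := by
  refine forall_push fun a a₀ => forall_push fun b b₀ => forall_push fun x x₀ =>
    forall_push fun x' x₁ => forall_push fun y y₀ => forall_push fun y' y₁ => fun hx hy => ?_
  rw [prefixMarginal_push_right P hi, prefixMarginal_push_right P hi]
  simp only [h]
  exact hF b₀ _ _ _ _ _ _ ((agreeUpTo_push hi).1 hx) (agreeUpTo_succ_push.1 hy).1

/-- A table does not depend on Bob's inputs when Alice's inputs vanish. -/
def ConstAtZero (P : Table n) : Prop :=
  ∀ a b y y', P a b (zeros n) y = P a b (zeros n) y'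

theorem zeros_succ : zeros (n + 1) = push (zeros n) false := push_zeros.symm

theorem ConstAtZero.extend {P C D : Table n} (hP : ConstAtZero P) (hC : ConstAtZero C)
    (hD : ConstAtZero D) : ConstAtZero (extend P C D) := by
  rw [ConstAtZero, zeros_succ]
  refine forall_push fun a a₀ => forall_push fun b b₀ => forall_push fun y y₀ =>
    forall_push fun y' y₁ => ?_
  rw [extend_push, extend_push, hP a b y y', hC a b y y', hD a b y y', Bool.false_and,
    Bool.false_and]

theorem ConstAtZero.extendMul {τ : Bool → Bool → Bool → ℝ} {D : Table n} (hD : ConstAtZero D) :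
    ConstAtZero (extendMul τ D) := by
  rw [ConstAtZero, zeros_succ]
  refine forall_push fun a a₀ => forall_push fun b b₀ => forall_push fun y y₀ =>
    forall_push fun y' y₁ => ?_
  rw [extendMul_push, extendMul_push, hD a b y y', Bool.false_and, Bool.false_and]

/-- Bob's marginal in the new round is `P / 2 ± C` for every input, so `C` must satisfy
no-signaling. The error mass `D` needs no such condition: it drops out of Alice's marginal when her
inputs are not all zero, and at zero inputs nothing depends on `y`. -/
theorem TONS.extend {P C D : Table n} (hP : TONS P) (hC : ∀ i ≤ n, PrefixNoSignaling C i n)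
    (hP0 : ConstAtZero P) (hC0 : ConstAtZero C) (hD0 : ConstAtZero D) : TONS (extend P C D) := by
  intro i hi
  have hi := Nat.lt_succ_iff.1 hi
  constructor
  · refine prefixNoSignaling_right_of_sum hi (F := fun c a b x y =>
      1 / 2 * P a b x y + (if c then -1 else 1) * C a b x y)
      (fun c => (hP.right hi).linear (hC i hi) _ _) fun a b x y b₀ x₀ y₀ => ?_
    simp only [extend_push, Fintype.sum_bool]
    cases isNonzero (push x x₀) <;> cases b₀ <;> cases x₀ <;> cases y₀ <;>
      simp [roundKernel] <;> ring
  · refine forall_push fun a a₀ => forall_push fun b b₀ => forall_push fun x x₀ =>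
      forall_push fun x' x₁ => forall_push fun y y₀ => forall_push fun y' y₁ => fun hx hy => ?_
    obtain ⟨hx', rfl⟩ := agreeUpTo_succ_push.1 hx
    obtain rfl := agreeUpTo_self.1 hx'
    by_cases h0 : push x x₀ = zeros (n + 1)
    · simp only [h0, prefixMarginal]
      simp only [hP0.extend hC0 hD0 _ _ (push y y₀) (push y' y₁)]
    · rw [prefixMarginal_push_left _ hi, prefixMarginal_push_left _ hi]
      have key : ∀ a b y y₀, ∑ b', _root_.extend P C D (push a a₀) (push b b') (push x x₀)
          (push y y₀) = 1 / 2 * P a b x y + 0 * P a b x y := by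
        intro a b y y₀
        have h1 : isNonzero (push x x₀) = true := decide_eq_true h0
        simp only [extend_push, Fintype.sum_bool, h1]
        cases a₀ <;> cases x₀ <;> cases y₀ <;> simp [roundKernel] <;> ring
      have := (hP.left hi).linear (hP.left hi) (1 / 2) 0 a b x x y y' hx'
        ((agreeUpTo_push hi).1 hy)
      simp only [prefixMarginal] at this ⊢
      simpa only [key] using this

theorem HasErrorLaw.extend {ε : ℝ} {P C D : Table n} (hP : HasErrorLaw ε P)
    (hD : ∀ e x y, ∑ a, D a (a ^^^ e ^^^ (x &&& y)) x y = ε * errorWeight ε e) :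
    HasErrorLaw ε (extend P C D) := by
  refine forall_push fun e e₀ => forall_push fun x x₀ => forall_push fun y y₀ => ?_
  have key : ∀ a : BitString n,
      _root_.extend P C D (push a false) (push a false ^^^ push e e₀ ^^^ (push x x₀ &&& push y y₀))
        (push x x₀) (push y y₀) +
      _root_.extend P C D (push a true) (push a true ^^^ push e e₀ ^^^ (push x x₀ &&& push y y₀))
        (push x x₀) (push y y₀) = (if e₀ then 0 else 1) * P a (a ^^^ e ^^^ (x &&& y)) x y +
          (if e₀ then 1 else -1) * D a (a ^^^ e ^^^ (x &&& y)) x y := by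
    intro a
    rw [push_and_push, push_xor_push, push_xor_push, push_xor_push, push_xor_push, extend_push,
      extend_push]
    cases isNonzero (push x x₀) <;> cases e₀ <;> cases x₀ <;> cases y₀ <;>
      simp [roundKernel] <;> ring
  rw [sum_push]
  simp only [key, Finset.sum_add_distrib, ← Finset.mul_sum, hP e x y, hD e x y, errorWeight_push]
  split_ifs <;> ring

theorem sum_error_extendMul {ε : ℝ} {τ : Bool → Bool → Bool → ℝ}
    (hτ : ∀ t e, τ t false e + τ t true e = if e then ε else 1 - ε) {D : Table n}
    (hD : ∀ e x y, ∑ a, D a (a ^^^ e ^^^ (x &&& y)) x y = ε * errorWeight ε e)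
    (e x y : BitString (n + 1)) :
    ∑ a, extendMul τ D a (a ^^^ e ^^^ (x &&& y)) x y = ε * errorWeight ε e := by
  revert e x y
  refine forall_push fun e e₀ => forall_push fun x x₀ => forall_push fun y y₀ => ?_
  have key : ∀ a : BitString n,
      extendMul τ D (push a false) (push a false ^^^ push e e₀ ^^^ (push x x₀ &&& push y y₀))
        (push x x₀) (push y y₀) +
      extendMul τ D (push a true) (push a true ^^^ push e e₀ ^^^ (push x x₀ &&& push y y₀))
        (push x x₀) (push y y₀) =
        D a (a ^^^ e ^^^ (x &&& y)) x y * if e₀ then ε else 1 - ε := by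
    intro a
    rw [push_and_push, push_xor_push, push_xor_push, push_xor_push, push_xor_push, extendMul_push,
      extendMul_push, ← hτ (isNonzero (push x x₀))]
    cases e₀ <;> cases x₀ <;> cases y₀ <;> simp <;> ring
  rw [sum_push]
  simp only [key, ← Finset.sum_mul, hD e x y, errorWeight_push]
  ring

/-- The weight of Bob's bit, summed over the error bit, is `m b` whether or not Alice's inputs
vanish. -/
theorem prefixNoSignaling_extendMul {τ : Bool → Bool → Bool → ℝ} {m : Bool → ℝ}
    (hτ : ∀ t b, τ t b false + τ t b true = m b) {D : Table n}
    (hD : ∀ i ≤ n, PrefixNoSignaling D i n) (i : ℕ) (hi : i ≤ n + 1) :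
    PrefixNoSignaling (extendMul τ D) i (n + 1) := by
  rcases hi.eq_or_lt with rfl | hi
  · exact prefixNoSignaling_self _
  have hi := Nat.lt_succ_iff.1 hi
  refine prefixNoSignaling_right_of_sum hi (F := fun c a b x y =>
    m c * D a b x y + 0 * D a b x y)
    (fun c => (hD i hi).linear (hD i hi) _ _) fun a b x y b₀ x₀ y₀ => ?_
  simp only [extendMul_push, Fintype.sum_bool, ← hτ (isNonzero (push x x₀))]
  cases b₀ <;> cases x₀ <;> cases y₀ <;> simp <;> ring

theorem zeroProb_extend (P C D : Table n) :
    zeroProb (extend P C D) = 1 / 2 * zeroProb P +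
      ∑ b, (C (zeros n) b (zeros n) (zeros n) + D (zeros n) b (zeros n) (zeros n)) := by
  rw [zeroProb, zeroProb, sum_push, Finset.mul_sum, ← Finset.sum_add_distrib, zeros_succ]
  refine Finset.sum_congr rfl fun b _ => ?_
  rw [extend_push, extend_push, push_zeros, isNonzero_zeros]
  simp [roundKernel]
  ring

theorem roundKernel_nonneg {t : Bool} {W C D : ℝ} (hC : 0 ≤ C) (hCD : C ≤ D) (hW : C + D ≤ W)
    (ht : t = false → C + D ≤ W / 2) (b e : Bool) : 0 ≤ roundKernel t W C D b e := by
  cases t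
  · have := ht rfl
    cases b <;> cases e <;> simp only [roundKernel] <;> linarith
  · cases b <;> cases e <;> simp only [roundKernel] <;> linarith

end Extension

/-! ### Optimal TONS tables -/

section TONSStrategies

variable {ε X : ℝ}

/-- The weights of Bob's output and the error bit in one round by which the error mass of later
rounds is multiplied. -/
noncomputable def errorFactor (ε : ℝ) : Bool → Bool → Bool → ℝ
  | false, false, false => 1 - ε
  | false, false, true => 0
  | false, true, false => 0
  | false, true, true => ε
  | true, false, false => 1 - 2 * ε
  | true, false, true => ε
  | true, true, false => ε
  | true, true, true => 0

/-- The indicator of output zero for Bob without an error. -/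
noncomputable def zeroFactor (_t b e : Bool) : ℝ := if b || e then 0 else 1

/-- The error mass in the first round. -/
noncomputable def errorMassOne (ε : ℝ) : Table 0 := fun _ _ _ _ => ε

/-- The error mass in the second round. -/
noncomputable def errorMassTwo (ε : ℝ) : Table 1 := extendMul (errorFactor ε) (errorMassOne ε)

/-- The error mass in the third round, before the correction for large noise. -/
noncomputable def errorMassThree (ε : ℝ) : Table 2 := extendMul (errorFactor ε) (errorMassTwo ε)

/-- The indicator of output zero for Bob without an error in two rounds. -/
noncomputable def zeroIndicator : Table 2 :=
  extendMul zeroFactor (extendMul zeroFactor fun _ _ _ _ => 1)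

/-- A transfer of error mass between histories without an error at vanishing inputs: from Bob's
outputs `00` to Bob's outputs `01`. -/
noncomputable def errorTransfer : Table 2 := fun a b x _ =>
  if x = zeros 2 ∧ a = b then (if b = zeros 2 then -1 else if b = ![false, true] then 1 else 0)
    else 0

/-- The biases in the third round. -/
noncomputable def biasThree (ε X : ℝ) : Table 2 := fun a b x y =>
  1 * errorMassThree ε a b x y + -X * zeroIndicator a b x y

/-- The error mass in the third round. -/
noncomputable def errorMassThree' (ε X : ℝ) : Table 2 := fun a b x y =>
  errorMassThree ε a b x y + X * errorTransfer a b x y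

/-- One round of the optimal strategy. -/
noncomputable def tableOne (ε : ℝ) : Table 1 :=
  extend (fun _ _ _ _ => 1) (errorMassOne ε) (errorMassOne ε)

/-- Two rounds of the optimal strategy. -/
noncomputable def tableTwo (ε : ℝ) : Table 2 :=
  extend (tableOne ε) (errorMassTwo ε) (errorMassTwo ε)

/-- Three rounds of the optimal strategy. -/
noncomputable def tableThree (ε X : ℝ) : Table 3 :=
  extend (tableTwo ε) (biasThree ε X) (errorMassThree' ε X)

/-- `errorFactor` is a joint law of two bits, each equal to one with probability `ε`. At zero inputs
it lives on `b = e`, so that all later error mass sits where Alice's outputs vanish; at nonzero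
inputs `b` and `e` are never both one. -/
theorem errorFactor_sum_error (t b : Bool) :
    errorFactor ε t b false + errorFactor ε t b true = if b then ε else 1 - ε := by
  cases t <;> cases b <;> simp [errorFactor]; ring

theorem errorFactor_sum_bob (t e : Bool) :
    errorFactor ε t false e + errorFactor ε t true e = if e then ε else 1 - ε := by
  cases t <;> cases e <;> simp [errorFactor]; ring

theorem zeroFactor_sum_error (t b : Bool) :
    zeroFactor t b false + zeroFactor t b true = if b then 0 else 1 := by
  cases b <;> simp [zeroFactor]

theorem constAtZero_const (c : ℝ) : ConstAtZero (n := 0) fun _ _ _ _ => c := fun _ _ _ _ => rfl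

theorem tons_zero (P : Table 0) : TONS P := fun i hi => absurd hi (Nat.not_lt_zero i)

theorem prefixNoSignaling_zero (P : Table 0) (i : ℕ) (hi : i ≤ 0) : PrefixNoSignaling P i 0 := by
  rw [Nat.le_zero.1 hi]
  exact prefixNoSignaling_self P

theorem sum_errorMassOne (e x y : BitString 0) :
    ∑ a, errorMassOne ε a (a ^^^ e ^^^ (x &&& y)) x y = ε * errorWeight ε e := by
  simp [errorMassOne, errorWeight]

theorem prefixNoSignaling_errorMassTwo : ∀ i ≤ 1, PrefixNoSignaling (errorMassTwo ε) i 1 :=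
  prefixNoSignaling_extendMul errorFactor_sum_error (prefixNoSignaling_zero _)

theorem tons_tableTwo : TONS (tableTwo ε) :=
  ((tons_zero _).extend (prefixNoSignaling_zero _) (constAtZero_const _) (constAtZero_const _)
    (constAtZero_const _)).extend prefixNoSignaling_errorMassTwo
    ((constAtZero_const _).extend (constAtZero_const _) (constAtZero_const _))
    (constAtZero_const _).extendMul (constAtZero_const _).extendMul

theorem hasErrorLaw_tableTwo : HasErrorLaw ε (tableTwo ε) := by
  refine HasErrorLaw.extend (HasErrorLaw.extend (fun e x y => ?_) sum_errorMassOne)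
    (sum_error_extendMul errorFactor_sum_bob sum_errorMassOne)
  simp [errorWeight]

theorem constAtZero_tableTwo : ConstAtZero (tableTwo ε) :=
  ((constAtZero_const _).extend (constAtZero_const _) (constAtZero_const _)).extend
    (constAtZero_const _).extendMul (constAtZero_const _).extendMul

theorem constAtZero_errorMassThree : ConstAtZero (errorMassThree ε) :=
  (constAtZero_const _).extendMul.extendMul

theorem constAtZero_zeroIndicator : ConstAtZero zeroIndicator :=
  (constAtZero_const _).extendMul.extendMul

/-- The bias is reduced by `X` at all inputs, since it has to be no-signaling, whereas the error
mass is changed at zero inputs only. -/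
theorem tons_tableThree : TONS (tableThree ε X) := by
  refine tons_tableTwo.extend (fun i hi => PrefixNoSignaling.linear ?_ ?_ _ _)
    constAtZero_tableTwo (fun a b y y' => ?_) fun a b y y' => ?_
  · exact prefixNoSignaling_extendMul errorFactor_sum_error prefixNoSignaling_errorMassTwo i hi
  · exact prefixNoSignaling_extendMul zeroFactor_sum_error
      (prefixNoSignaling_extendMul zeroFactor_sum_error (prefixNoSignaling_zero _)) i hi
  · rw [biasThree, constAtZero_errorMassThree a b y y', constAtZero_zeroIndicator a b y y']
    rfl
  · rw [errorMassThree', constAtZero_errorMassThree a b y y']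
    rfl

/-- The transfer stays within error-free histories and has total zero. -/
theorem sum_errorTransfer (e x y : BitString 2) :
    ∑ a, errorTransfer a (a ^^^ e ^^^ (x &&& y)) x y = 0 := by
  by_cases hx : x = zeros 2
  · have h : ∀ a : BitString 2, a = a ^^^ e ↔ e = zeros 2 := fun a =>
      ⟨fun h => by rw [← zeros_bxor e, ← bxor_self a, bxor_assoc, ← h], fun h => by simp [h]⟩
    simp only [errorTransfer, hx, zeros_and, bxor_zeros, h, true_and]
    by_cases he : e = zeros 2
    · simp only [he, if_true, bxor_zeros]
      rw [sum_two]
      simp [(zeros 2).eq_two]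
    · simp [he]
  · simp [errorTransfer, hx]

theorem hasErrorLaw_tableThree : HasErrorLaw ε (tableThree ε X) := by
  refine hasErrorLaw_tableTwo.extend fun e x y => ?_
  simp only [errorMassThree']
  rw [Finset.sum_add_distrib, ← Finset.mul_sum, sum_errorTransfer, mul_zero, add_zero]
  exact sum_error_extendMul errorFactor_sum_bob
    (sum_error_extendMul errorFactor_sum_bob sum_errorMassOne) e x y

theorem zeroProb_tableTwo : zeroProb (tableTwo ε) = 1 / 4 + 3 * ε := by
  rw [tableTwo, zeroProb_extend, tableOne, zeroProb_extend, sum_push]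
  simp only [Fintype.sum_subsingleton _ (zeros 0), zeroProb, errorMassTwo, ← push_zeros,
    extendMul_push, errorMassOne]
  rw [push_zeros, isNonzero_zeros]
  simp [errorFactor]
  ring

/-- The weight of two rounds of the optimal strategy, in terms of the bits of the history. -/
noncomputable def weightBits (ε : ℝ) (t₁ t₂ b₁ e₁ b₂ e₂ : Bool) : ℝ :=
  roundKernel t₂ (roundKernel t₁ 1 ε ε b₁ e₁) (ε * errorFactor ε t₁ b₁ e₁)
    (ε * errorFactor ε t₁ b₁ e₁) b₂ e₂

/-- The bias in the third round, in terms of the bits of the history. -/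
noncomputable def biasBits (ε X : ℝ) (t t' b e b' e' : Bool) : ℝ :=
  ε * errorFactor ε t b e * errorFactor ε t' b' e' - X * if b || e || b' || e' then 0 else 1

/-- The error mass in the third round, in terms of the bits of the history. -/
noncomputable def errorBits (ε X : ℝ) (t t' b e b' e' : Bool) : ℝ :=
  ε * errorFactor ε t b e * errorFactor ε t' b' e' +
    X * if t' || e || e' || b then 0 else if b' then 1 else -1

theorem tableTwo_eq (a b x y : BitString 2) :
    tableTwo ε a b x y = weightBits ε (isNonzero (pop x)) (isNonzero x)
      (b 0) (a 0 ^^ b 0 ^^ (x 0 && y 0)) (b 1) (a 1 ^^ b 1 ^^ (x 1 && y 1)) := rfl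

theorem biasThree_eq (a b x y : BitString 2) :
    biasThree ε X a b x y = biasBits ε X (isNonzero (pop x)) (isNonzero x)
      (b 0) (a 0 ^^ b 0 ^^ (x 0 && y 0)) (b 1) (a 1 ^^ b 1 ^^ (x 1 && y 1)) := by
  have h1 : errorMassThree ε a b x y = ε * errorFactor ε (isNonzero (pop x)) (b 0)
      (a 0 ^^ b 0 ^^ (x 0 && y 0)) * errorFactor ε (isNonzero x) (b 1)
      (a 1 ^^ b 1 ^^ (x 1 && y 1)) := rfl
  have h2 : zeroIndicator a b x y = 1 * zeroFactor (isNonzero (pop x)) (b 0)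
      (a 0 ^^ b 0 ^^ (x 0 && y 0)) * zeroFactor (isNonzero x) (b 1)
      (a 1 ^^ b 1 ^^ (x 1 && y 1)) := rfl
  rw [biasThree, biasBits, h1, h2]
  generalize (a 0 ^^ b 0 ^^ (x 0 && y 0)) = e
  generalize (a 1 ^^ b 1 ^^ (x 1 && y 1)) = e'
  cases b 0 <;> cases e <;> cases b 1 <;> cases e' <;> simp [zeroFactor]
  ring

theorem errorMassThree'_eq (a b x y : BitString 2) :
    errorMassThree' ε X a b x y = errorBits ε X (isNonzero (pop x)) (isNonzero x)
      (b 0) (a 0 ^^ b 0 ^^ (x 0 && y 0)) (b 1) (a 1 ^^ b 1 ^^ (x 1 && y 1)) := by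
  have h1 : errorMassThree ε a b x y = ε * errorFactor ε (isNonzero (pop x)) (b 0)
      (a 0 ^^ b 0 ^^ (x 0 && y 0)) * errorFactor ε (isNonzero x) (b 1)
      (a 1 ^^ b 1 ^^ (x 1 && y 1)) := rfl
  rw [errorMassThree', errorBits, h1]
  congr 2
  by_cases hx : x = zeros 2
  · simp only [errorTransfer, hx, isNonzero_zeros, zeros_apply, Bool.false_and, Bool.xor_false,
      true_and, Bool.false_or]
    revert a
    refine forall_two fun a a' => ?_
    revert b
    refine forall_two fun b b' => ?_
    rw [(zeros 2).eq_two]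
    cases a <;> cases a' <;> cases b <;> cases b' <;> simp
  · have : isNonzero x = true := decide_eq_true hx
    simp [errorTransfer, hx, this]

/-- The zero history loses `X` once in the bias and once in the error mass. -/
theorem zeroProb_tableThree : zeroProb (tableThree ε X) = 1 / 8 + 7 / 2 * ε - 2 * X := by
  rw [tableThree, zeroProb_extend, zeroProb_tableTwo, sum_two]
  have h : isNonzero (pop (zeros 2)) = false := isNonzero_zeros
  simp only [biasThree_eq, errorMassThree'_eq, isNonzero_zeros, h, zeros_apply]
  simp [biasBits, errorBits, errorFactor]
  ring

theorem isNonzero_pop {n : ℕ} {x : BitString (n + 1)} (h : isNonzero x = false) :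
    isNonzero (pop x) = false := by
  rw [isNonzero, decide_eq_false_iff_not, not_not] at h
  rw [h]
  exact isNonzero_zeros

theorem errorFactor_nonneg (h0 : 0 ≤ ε) (h4 : ε ≤ 1 / 4) (t b e : Bool) :
    0 ≤ errorFactor ε t b e := by
  cases t <;> cases b <;> cases e <;> simp only [errorFactor] <;> linarith

theorem errorFactor_le_roundKernel (h0 : 0 ≤ ε) (h4 : ε ≤ 1 / 4) (t b e : Bool) :
    ε * errorFactor ε t b e + ε * errorFactor ε t b e ≤ roundKernel t 1 ε ε b e ∧
      (t = false →
        ε * errorFactor ε t b e + ε * errorFactor ε t b e ≤ roundKernel t 1 ε ε b e / 2) := by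
  cases t <;> cases b <;> cases e <;> simp [errorFactor, roundKernel] <;>
    first | nlinarith | (constructor <;> nlinarith)

theorem weightBits_nonneg (h0 : 0 ≤ ε) (h4 : ε ≤ 1 / 4) {t t' : Bool}
    (ht : t' = false → t = false) (b e b' e' : Bool) : 0 ≤ weightBits ε t t' b e b' e' :=
  roundKernel_nonneg (mul_nonneg h0 (errorFactor_nonneg h0 h4 t b e)) le_rfl
    (errorFactor_le_roundKernel h0 h4 t b e).1
    (fun h => (errorFactor_le_roundKernel h0 h4 t b e).2 (ht h)) b' e'

/-- The bound on `X` is needed for nonzero inputs in both rounds, where the uncorrected bias of the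
zero history is `ε (1 - 2ε)²`. -/
theorem biasBits_nonneg (h0 : 0 ≤ ε) (h4 : ε ≤ 1 / 4) (hX : X ≤ ε * (1 - 2 * ε) ^ 2)
    (t t' b e b' e' : Bool) : 0 ≤ biasBits ε X t t' b e b' e' := by
  have h := mul_nonneg (mul_nonneg h0 (errorFactor_nonneg h0 h4 t b e))
    (errorFactor_nonneg h0 h4 t' b' e')
  have h2 : 0 ≤ ε * ε := mul_nonneg h0 h0
  have h3 : 0 ≤ ε * ε * (1 / 4 - ε) := mul_nonneg h2 (by linarith)
  rw [biasBits]
  cases b <;> cases e <;> cases b' <;> cases e' <;> simp only [Bool.or_self, Bool.or_true,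
    Bool.or_false, if_true, Bool.false_eq_true, if_false, mul_zero, sub_zero, h]
  cases t <;> cases t' <;> simp only [errorFactor] <;> nlinarith

theorem biasBits_le_errorBits (hX : 0 ≤ X) (t t' b e b' e' : Bool) :
    biasBits ε X t t' b e b' e' ≤ errorBits ε X t t' b e b' e' := by
  rw [biasBits, errorBits]
  cases t' <;> cases b <;> cases e <;> cases b' <;> cases e' <;> simp <;> linarith

/-- Both bounds on `X` come from error-free histories at zero inputs. The lower bound is the
condition at Bob's outputs `00`, of weight `1/4 + 3ε/2 - ε²`; the upper bound is the one at `01`, of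
weight `(1 - 4ε)(1 - 2ε) / 4`, which receives the transferred mass. -/
theorem biasBits_add_errorBits_le (h0 : 0 ≤ ε) (h4 : ε ≤ 1 / 4)
    (hX : ε * (1 - ε) ^ 2 - (1 / 16 + 3 / 8 * ε - ε ^ 2 / 4) ≤ X)
    (hX' : X ≤ (1 - 4 * ε) * (1 - 2 * ε) / 8) {t t' : Bool} (ht : t' = false → t = false)
    (b e b' e' : Bool) :
    biasBits ε X t t' b e b' e' + errorBits ε X t t' b e b' e' ≤ weightBits ε t t' b e b' e' ∧
      (t' = false → biasBits ε X t t' b e b' e' + errorBits ε X t t' b e b' e' ≤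
        weightBits ε t t' b e b' e' / 2) := by
  have hW := weightBits_nonneg h0 h4 ht b e b' e'
  have h1 : 0 ≤ 1 / 4 - ε := by linarith
  have h2 : 0 ≤ ε * ε := mul_nonneg h0 h0
  have h3 : 0 ≤ ε * (1 / 4 - ε) := mul_nonneg h0 h1
  have h5 : 0 ≤ ε * ε * (1 / 4 - ε) := mul_nonneg h2 h1
  have h6 : 0 ≤ ε * ((1 / 4 - ε) * (1 / 4 - ε)) := mul_nonneg h0 (mul_nonneg h1 h1)
  have h7 : 0 ≤ ε * ε * ε := mul_nonneg h2 h0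
  have h8 : 0 ≤ (1 / 4 - ε) * (1 / 4 - ε) := mul_nonneg h1 h1
  cases t'
  · obtain rfl := ht rfl
    suffices biasBits ε X false false b e b' e' + errorBits ε X false false b e b' e' ≤
        weightBits ε false false b e b' e' / 2 from ⟨by linarith, fun _ => this⟩
    clear hW
    cases b <;> cases e <;> cases b' <;> cases e' <;>
      simp [biasBits, errorBits, weightBits, roundKernel, errorFactor] <;> nlinarith
  · refine ⟨?_, fun h => absurd h (by decide)⟩
    clear hW
    cases t <;> cases b <;> cases e <;> cases b' <;> cases e' <;>
      simp [biasBits, errorBits, weightBits, roundKernel, errorFactor] <;> nlinarith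

theorem tableTwo_nonneg (h0 : 0 ≤ ε) (h4 : ε ≤ 1 / 4) (a b x y : BitString 2) :
    0 ≤ tableTwo ε a b x y :=
  weightBits_nonneg h0 h4 isNonzero_pop _ _ _ _

theorem isBehavior_tableTwo (h0 : 0 ≤ ε) (h4 : ε ≤ 1 / 4) : IsBehavior (tableTwo ε) :=
  ⟨tableTwo_nonneg h0 h4, hasErrorLaw_tableTwo.sum_eq_one⟩

theorem isBehavior_tableThree (h0 : 0 ≤ ε) (h4 : ε ≤ 1 / 4) (hX0 : 0 ≤ X)
    (hX : ε * (1 - ε) ^ 2 - (1 / 16 + 3 / 8 * ε - ε ^ 2 / 4) ≤ X)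
    (hX' : X ≤ (1 - 4 * ε) * (1 - 2 * ε) / 8) (hX'' : X ≤ ε * (1 - 2 * ε) ^ 2) :
    IsBehavior (tableThree ε X) := by
  refine ⟨fun a b x y => ?_, hasErrorLaw_tableThree.sum_eq_one⟩
  rw [tableThree, extend, biasThree_eq, errorMassThree'_eq, tableTwo_eq]
  have key := biasBits_add_errorBits_le h0 h4 hX hX' (isNonzero_pop (x := pop x))
  exact roundKernel_nonneg (biasBits_nonneg h0 h4 hX'' _ _ _ _ _ _)
    (biasBits_le_errorBits hX0 _ _ _ _ _ _) (key _ _ _ _).1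
    (fun h => (key _ _ _ _).2 (isNonzero_pop h)) _ _

variable {v : ℝ}

theorem isGuessingProb_two_tons (hv : v ∈ Set.Icc (0 : ℝ) 1) :
    IsGuessingProb (n := 2) TONS v (1 - 3 / 4 * v) ∧
      IsGuessingProb (n := 2) WTONS v (1 - 3 / 4 * v) := by
  obtain ⟨hv0, hv1⟩ := hv
  have hB := isBehavior_tableTwo (ε := (1 - v) / 4) (by linarith) (by linarith)
  have hle : ∀ R : Table 2, IsBehavior R → WTONS R → HasErrorLaw ((1 - v) / 4) R →
      zeroProb R ≤ 1 - 3 / 4 * v := fun R hB hR hE =>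
    (hR.zeroProb_two_le hB.nonneg hE).trans_eq (by ring)
  have hge : 1 - 3 / 4 * v ≤ zeroProb (tableTwo ((1 - v) / 4)) := by
    rw [zeroProb_tableTwo]
    linarith
  exact ⟨isGuessingProb_of_forall_le isSymmetricClass_tons (fun R hB hR => hle R hB hR.wtons)
    ⟨_, hB, tons_tableTwo, hasErrorLaw_tableTwo, hge⟩,
    isGuessingProb_of_forall_le isSymmetricClass_wtons hle
    ⟨_, hB, tons_tableTwo.wtons, hasErrorLaw_tableTwo, hge⟩⟩

theorem isGuessingProb_three_tons {g : ℝ}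
    (hle : ∀ R : Table 3, IsBehavior R → WTONS R → HasErrorLaw ((1 - v) / 4) R → zeroProb R ≤ g)
    (hB : IsBehavior (tableThree ((1 - v) / 4) X))
    (hg : 1 / 8 + 7 / 2 * ((1 - v) / 4) - 2 * X = g) :
    IsGuessingProb (n := 3) TONS v g ∧ IsGuessingProb (n := 3) WTONS v g := by
  have hge : g ≤ zeroProb (tableThree ((1 - v) / 4) X) := by rw [zeroProb_tableThree, hg]
  exact ⟨isGuessingProb_of_forall_le isSymmetricClass_tons (fun R hB hR => hle R hB hR.wtons)
    ⟨_, hB, tons_tableThree, hasErrorLaw_tableThree, hge⟩,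
    isGuessingProb_of_forall_le isSymmetricClass_wtons hle
    ⟨_, hB, tons_tableThree.wtons, hasErrorLaw_tableThree, hge⟩⟩

theorem isGuessingProb_three_tons_of_le (hv : v ∈ Set.Icc (0 : ℝ) 1) (h : v ≤ √5 - 2) :
    IsGuessingProb (n := 3) TONS v (1 - 29 / 32 * v + 1 / 8 * v ^ 2 + 1 / 32 * v ^ 3) ∧
      IsGuessingProb (n := 3) WTONS v (1 - 29 / 32 * v + 1 / 8 * v ^ 2 + 1 / 32 * v ^ 3) := by
  obtain ⟨hv0, hv1⟩ := hv
  have hq : v ^ 2 + 4 * v ≤ 1 := by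
    nlinarith [Real.sq_sqrt (show (0 : ℝ) ≤ 5 by norm_num), Real.sqrt_nonneg 5]
  -- The smallest `X` allowed at Bob's history `00`. There Alice's third output is then surely zero,
  -- which makes the trivial third-round bound tight. It vanishes at `v = √5 - 2`.
  refine isGuessingProb_three_tons (X := v * (1 - 4 * v - v ^ 2) / 64)
    (fun R hB hR hE => (hR.zeroProb_three_le' hB.nonneg hE).trans_eq (by ring))
    (isBehavior_tableThree (by linarith) (by linarith) ?_ ?_ ?_ ?_) (by ring)
  · exact div_nonneg (mul_nonneg hv0 (by linarith)) (by norm_num)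
  · exact le_of_eq (by ring)
  · nlinarith
  · nlinarith [mul_nonneg hv0 hv0]

theorem isGuessingProb_three_tons_of_ge (hv : v ∈ Set.Icc (0 : ℝ) 1) (h : √5 - 2 ≤ v) :
    IsGuessingProb (n := 3) TONS v (1 - 7 / 8 * v) ∧
      IsGuessingProb (n := 3) WTONS v (1 - 7 / 8 * v) := by
  obtain ⟨hv0, hv1⟩ := hv
  have hq : 1 ≤ v ^ 2 + 4 * v := by
    nlinarith [Real.sq_sqrt (show (0 : ℝ) ≤ 5 by norm_num), Real.sqrt_nonneg 5]
  refine isGuessingProb_three_tons (X := 0)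
    (fun R hB hR hE => (hR.zeroProb_three_le hB.nonneg hE).trans_eq (by ring))
    (isBehavior_tableThree (by linarith) (by linarith) le_rfl ?_ ?_ ?_) (by ring)
  · nlinarith [mul_nonneg hv0 (sub_nonneg.2 hq)]
  · nlinarith
  · exact mul_nonneg (by linarith) (sq_nonneg _)

end TONSStrategies

/-! ### Break points and the main theorem -/

theorem exists_firstBreakPoint : ∃ w ∈ Set.Icc (0.220375 : ℝ) 0.220385,
    w ^ 3 - 3 * w ^ 2 - 13 * w + 3 = 0 :=
  intermediate_value_Icc' (f := fun x : ℝ => x ^ 3 - 3 * x ^ 2 - 13 * x + 3) (by norm_num)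
    (by fun_prop) ⟨by norm_num, by norm_num⟩

theorem exists_secondBreakPoint : ∃ w ∈ Set.Icc (0.709275 : ℝ) 0.709285,
    w ^ 3 + 5 * w ^ 2 + 3 * w - 5 = 0 :=
  intermediate_value_Icc (f := fun x : ℝ => x ^ 3 + 5 * x ^ 2 + 3 * x - 5) (by norm_num)
    (by fun_prop) ⟨by norm_num, by norm_num⟩

theorem firstCubic_strictAntiOn :
    StrictAntiOn (fun x : ℝ => x ^ 3 - 3 * x ^ 2 - 13 * x + 3) (Set.Icc 0 1) := by
  rintro x ⟨hx0, hx1⟩ y ⟨hy0, hy1⟩ hxy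
  have h : 0 < (y - x) * (13 + 3 * (x + y) - (x ^ 2 + x * y + y ^ 2)) :=
    mul_pos (by linarith) (by nlinarith)
  dsimp only
  linarith

theorem secondCubic_strictMonoOn :
    StrictMonoOn (fun x : ℝ => x ^ 3 + 5 * x ^ 2 + 3 * x - 5) (Set.Icc 0 1) := by
  rintro x ⟨hx0, hx1⟩ y ⟨hy0, hy1⟩ hxy
  have h : 0 < (y - x) * (3 + 5 * (x + y) + (x ^ 2 + x * y + y ^ 2)) :=
    mul_pos (by linarith) (by positivity)
  dsimp only
  linarith

theorem mainTheorem1 :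
    ∃ v₁ v₂ : ℝ,
      -- the break points for three copies under ABNS
      (v₁ ∈ Set.Icc (0 : ℝ) 1 ∧ v₁ ^ 3 - 3 * v₁ ^ 2 - 13 * v₁ + 3 = 0 ∧
        (∀ x ∈ Set.Icc (0 : ℝ) 1, x ^ 3 - 3 * x ^ 2 - 13 * x + 3 = 0 → x = v₁) ∧
        |v₁ - 0.22038| < 0.00001) ∧
      (v₂ ∈ Set.Icc (0 : ℝ) 1 ∧ v₂ ^ 3 + 5 * v₂ ^ 2 + 3 * v₂ - 5 = 0 ∧
        (∀ x ∈ Set.Icc (0 : ℝ) 1, x ^ 3 + 5 * x ^ 2 + 3 * x - 5 = 0 → x = v₂) ∧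
        |v₂ - 0.70928| < 0.00001) ∧
      ∀ v ∈ Set.Icc (0 : ℝ) 1,
        -- two copies, ABNS
        (v ≤ √2 - 1 → IsGuessingProb (n := 2) ABNS v (1 - 1 / 2 * v)) ∧
        (√2 - 1 ≤ v →
          IsGuessingProb (n := 2) ABNS v (9 / 8 - 3 / 4 * v - 1 / 8 * v ^ 2)) ∧
        -- two copies, TONS and WTONS
        IsGuessingProb (n := 2) TONS v (1 - 3 / 4 * v) ∧
        IsGuessingProb (n := 2) WTONS v (1 - 3 / 4 * v) ∧
        -- three copies, ABNS
        (v ≤ v₁ → IsGuessingProb (n := 3) ABNS v (1 - 1 / 2 * v)) ∧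
        (v₁ ≤ v → v ≤ v₂ →
          IsGuessingProb (n := 3) ABNS v
            (67 / 64 - 45 / 64 * v - 3 / 64 * v ^ 2 + 1 / 64 * v ^ 3)) ∧
        (v₂ ≤ v →
          IsGuessingProb (n := 3) ABNS v
            (41 / 32 - 27 / 32 * v - 9 / 32 * v ^ 2 - 1 / 32 * v ^ 3)) ∧
        -- three copies, TONS and WTONS
        (v ≤ √5 - 2 →
          IsGuessingProb (n := 3) TONS v
            (1 - 29 / 32 * v + 1 / 8 * v ^ 2 + 1 / 32 * v ^ 3)) ∧
        (v ≤ √5 - 2 →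
          IsGuessingProb (n := 3) WTONS v
            (1 - 29 / 32 * v + 1 / 8 * v ^ 2 + 1 / 32 * v ^ 3)) ∧
        (√5 - 2 ≤ v → IsGuessingProb (n := 3) TONS v (1 - 7 / 8 * v)) ∧
        (√5 - 2 ≤ v → IsGuessingProb (n := 3) WTONS v (1 - 7 / 8 * v)) := by
  obtain ⟨v₁, ⟨hl₁, hu₁⟩, hv₁⟩ := exists_firstBreakPoint
  obtain ⟨v₂, ⟨hl₂, hu₂⟩, hv₂⟩ := exists_secondBreakPoint
  have m₁ : v₁ ∈ Set.Icc (0 : ℝ) 1 := ⟨by linarith, by linarith⟩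
  have m₂ : v₂ ∈ Set.Icc (0 : ℝ) 1 := ⟨by linarith, by linarith⟩
  refine ⟨v₁, v₂, ⟨m₁, hv₁, fun x hx h => firstCubic_strictAntiOn.injOn hx m₁ (h.trans hv₁.symm),
    abs_lt.2 ⟨by linarith, by linarith⟩⟩,
    ⟨m₂, hv₂, fun x hx h => secondCubic_strictMonoOn.injOn hx m₂ (h.trans hv₂.symm),
    abs_lt.2 ⟨by linarith, by linarith⟩⟩, fun v hv => ⟨isGuessingProb_two_abns_of_le hv,
    isGuessingProb_two_abns_of_ge hv, (isGuessingProb_two_tons hv).1,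
    (isGuessingProb_two_tons hv).2, fun h => ?_, fun h h' => ?_, fun h => ?_,
    fun h => (isGuessingProb_three_tons_of_le hv h).1,
    fun h => (isGuessingProb_three_tons_of_le hv h).2,
    fun h => (isGuessingProb_three_tons_of_ge hv h).1,
    fun h => (isGuessingProb_three_tons_of_ge hv h).2⟩⟩
  · exact isGuessingProb_three_abns_high hv
      (hv₁.symm.trans_le (firstCubic_strictAntiOn.antitoneOn hv m₁ h))
  · exact isGuessingProb_three_abns_medium hv
      ((firstCubic_strictAntiOn.antitoneOn m₁ hv h).trans_eq hv₁)
      ((secondCubic_strictMonoOn.monotoneOn hv m₂ h').trans_eq hv₂)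
  · exact isGuessingProb_three_abns_low hv
      (hv₂.symm.trans_le (secondCubic_strictMonoOn.monotoneOn m₂ hv h))
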